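/- Equip $\mathbb{C}^3$ with the Hermitian form $\langle z,w\rangle=z_1\bar w_1+z_2\bar w_2-z_3\bar w_3$, and let $\mathrm{SU}(2,1)$ be the group of complex $3\times3$ matrices of determinant $1$ that preserve it. For an integer $p\ge 2$ put $u=e^{2\pi i/(3p)}$ and $\bar u^{1/2}=e^{-\pi i/(3p)}$. A complex reflection of order $p$ in $\mathrm{SU}(2,1)$, with polar vector $v$ satisfying $\langle v,v\rangle>0$, is the map $$R(z)=e^{-2\pi i/(3p)}\Bigl(z+(e^{2\pi i/p}-1)\frac{\langle z,v\rangle}{\langle v,v\rangle}\,v\Bigr);$$ it preserves the complex geodesic polar to $v$. For elements $a,b$ of a group, the braid length $br(a,b)$ is the least integer $l\ge1$ such that the alternating products $aba\cdots$ and $bab\cdots$ with $l$ factors each are equal. **Theorem.** Let $p\ge2$, let $R_1,R_2,R_3\in\mathrm{SU}(2,1)$ be complex reflections of order $p$, and suppose that there is $S\in\mathrm{SU}(2,1)$ with $$SR_1S^{-1}=R_1R_2R_1^{-1},\quad SR_2S^{-1}=R_1R_3R_1R_3^{-1}R_1^{-1},\quad SR_3S^{-1}=R_1R_3R_1^{-1},\quad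 S^2=R_1R_2R_3.$$ Suppose that $br(R_1,R_3)=n$ and $br(R_1,R_2)=m$ with integers $m,n\ge3$, and that $R_1R_2R_3$ has finite order. Then $(n,m)$ is one of $(3,4)$, $(3,5)$, $(4,3)$, $(5,4)$, $(8,6)$, or $(k,k)$ with $k\ge3$. Moreover, say that $(\rho,\sigma,\tau)$ are parameters of $(R_1,R_2,R_3)$ if there are polar vectors $v_1,v_2,v_3$ of $R_1,R_2,R_3$ with $\langle v_j,v_i\rangle=H_{ij}$, where $$H=\begin{pmatrix}\alpha&\beta_1&\bar\beta_3\\ \bar\beta_1&\alpha&\beta_2\\ \beta_3&\bar\beta_2&\alpha\end{pmatrix},\qquad \alpha=\sqrt{2-u^3-\bar u^3},\quad (\beta_1,\beta_2,\beta_3)=-i\bar u^{1/2}(\rho,\sigma,\tau).$$ Parameters with $\sigma,\tau$ real and non-negative exist, and all such parameters satisfy $\sigma=\tau$, $\sigma^2=\rho+\bar\rho$, $|\rho|=2\cos(k\pi/m)$ for some integer $k$ coprime to $m$ with $0<k<m/2$, and $\sigma=2\cos(l\pi/n)$ for some integer $l$ coprime to $n$ with $0<l<n/2$. If $|\rho|=2\cos(\pi/m)$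 and $\sigma=2\cos(\pi/n)$, then $\rho$ or its complex conjugate (written $\rho$ in the table), together with $s=\rho-1$ and $\sigma=\tau$, is given by the row of $(n,m)$ in the following table: $$\begin{array}{|l|lll|} \hline (n,m)&\rho&s=\rho-1&\sigma=\tau\\ \hline (3,4)&(1+i\sqrt7)/2&e^{2\pi i/7}+e^{4\pi i/7}+e^{-6\pi i/7}&1\\ (3,5)&2e^{2\pi i/5}\cos(\pi/5)&e^{2\pi i/5}+e^{7\pi i/15}+e^{-13\pi i/15}&1\\ (4,3)&1&0&\sqrt2\\ (5,4)&(1+i\sqrt3)(\sqrt5-i\sqrt3)/4&e^{-2\pi i/3}+e^{2\pi i/15}+e^{8\pi i/15}&(1+\sqrt5)/2\\ (8,6)&(1+i)(1-i/\sqrt2)&e^{\pi i/2}+e^{\pi i/12}+e^{-7\pi i/12}&\sqrt{2+\sqrt2}\\ (k,k),\ k\ge 3&2e^{i\pi/k}\cos(\pi/k)&e^{2\pi i/k}&2\cos(\pi/k)\\ \hline \end{array}$$ -/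

import Mathlib

open scoped Matrix ComplexConjugate

noncomputable section

/-- The standard Hermitian form of signature `(2,1)` on `ℂ³`. -/
def herm21 (z w : Fin 3 → ℂ) : ℂ :=
  z 0 * conj (w 0) + z 1 * conj (w 1) - z 2 * conj (w 2)

/-- The group `SU(2,1)` of complex `3 × 3` matrices of determinant one preserving `herm21`. -/
def SU21 : Subgroup (Matrix.SpecialLinearGroup (Fin 3) ℂ) where
  carrier := {A | ∀ z w : Fin 3 → ℂ, herm21 (A.1 *ᵥ z) (A.1 *ᵥ w) = herm21 z w}
  one_mem' := by
    intro z w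
    simp
  mul_mem' := by
    intro A B hA hB z w
    have h := hA (B.1 *ᵥ z) (B.1 *ᵥ w)
    rw [hB z w, Matrix.mulVec_mulVec, Matrix.mulVec_mulVec] at h
    simpa using h
  inv_mem' := by
    intro A hA z w
    have h := hA ((A⁻¹).1 *ᵥ z) ((A⁻¹).1 *ᵥ w)
    have e : A.1 * (A⁻¹).1 = 1 := congrArg Subtype.val (mul_inv_cancel A)
    rw [Matrix.mulVec_mulVec, Matrix.mulVec_mulVec, e, Matrix.one_mulVec, Matrix.one_mulVec] at h
    exact h.symm

/-- `R` is the complex reflection of order `p` (through the angle `φ = 2π/p`) in the complex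
geodesic with polar vector `v`, lifted to `SU(2,1)` by the factor `e^{-iφ/3}`. The vector `v` is
positive, so that its orthogonal complement does project to a complex geodesic. -/
def IsComplexReflection (p : ℕ) (v : Fin 3 → ℂ) (R : SU21) : Prop :=
  0 < (herm21 v v).re ∧
    ∀ z : Fin 3 → ℂ, R.1.1 *ᵥ z =
      Complex.exp (-(2 * Real.pi * Complex.I / (3 * p))) •
        (z + ((Complex.exp (2 * Real.pi * Complex.I / p) - 1) *
          (herm21 z v / herm21 v v)) • v)

/-- The alternating product `a b a ⋯` with `l` factors. -/
def altProd {G : Type*} [Group G] (a b : G) : ℕ → G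
  | 0 => 1
  | l + 1 => a * altProd b a l

/-- The braid length `br(a, b)` exists and equals `l`: the least positive `l` such that
`a b a ⋯ = b a b ⋯` with `l` factors on either side. -/
def HasBraidLength {G : Type*} [Group G] (a b : G) (l : ℕ) : Prop :=
  IsLeast {k : ℕ | 1 ≤ k ∧ altProd a b k = altProd b a k} l

/-- The Hermitian matrix `H` attached to `p` and the parameters `ρ, σ, τ`, with
`α = √(2 - u³ - ū³) = √(2 - 2 cos (2π/p))` and `β₁, β₂, β₃ = -i ū^{1/2} (ρ, σ, τ)`,
where `ū^{1/2} = e^{-πi/(3p)}`. -/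
def hermitianH (p : ℕ) (ρ σ τ : ℂ) : Matrix (Fin 3) (Fin 3) ℂ :=
  let α : ℂ := ((Real.sqrt (2 - 2 * Real.cos (2 * Real.pi / p)) : ℝ) : ℂ)
  let c : ℂ := -Complex.I * Complex.exp (-(Real.pi * Complex.I / (3 * p)))
  !![α, c * ρ, conj (c * τ);
     conj (c * ρ), α, c * σ;
     c * τ, conj (c * σ), α]

/-- `ρ, σ, τ` are parameters of the triple of reflections `R₁, R₂, R₃`: there are polar vectors
`v₁, v₂, v₃` of their mirrors with respect to which the Hermitian form has the matrix `H`, that is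
`⟨v_j, v_i⟩ = H_{ij}`. -/
def HasParameters (p : ℕ) (R₁ R₂ R₃ : SU21) (ρ σ τ : ℂ) : Prop :=
  ∃ v : Fin 3 → Fin 3 → ℂ,
    IsComplexReflection p (v 0) R₁ ∧ IsComplexReflection p (v 1) R₂ ∧
    IsComplexReflection p (v 2) R₃ ∧
    ∀ i j : Fin 3, herm21 (v j) (v i) = hermitianH p ρ σ τ i j

/-- `e^{iπx}`. -/
def expPi (x : ℝ) : ℂ := Complex.exp (((Real.pi * x : ℝ) : ℂ) * Complex.I)

/-- The rows `(n, m)`, `ρ`, `s`, `σ = τ` of the table of parameter values. -/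
def IsTableRow (n m : ℕ) (ρ s : ℂ) (σ : ℝ) : Prop :=
  (n = 3 ∧ m = 4 ∧ ρ = (1 + Complex.I * (Real.sqrt 7 : ℝ)) / 2 ∧
    s = expPi (2 / 7) + expPi (4 / 7) + expPi (-6 / 7) ∧ σ = 1) ∨
  (n = 3 ∧ m = 5 ∧ ρ = 2 * expPi (2 / 5) * (Real.cos (Real.pi / 5) : ℝ) ∧
    s = expPi (2 / 5) + expPi (7 / 15) + expPi (-13 / 15) ∧ σ = 1) ∨
  (n = 4 ∧ m = 3 ∧ ρ = 1 ∧ s = 0 ∧ σ = Real.sqrt 2) ∨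
  (n = 5 ∧ m = 4 ∧
    ρ = (1 + Complex.I * (Real.sqrt 3 : ℝ)) *
      ((Real.sqrt 5 : ℝ) - Complex.I * (Real.sqrt 3 : ℝ)) / 4 ∧
    s = expPi (-2 / 3) + expPi (2 / 15) + expPi (8 / 15) ∧ σ = (1 + Real.sqrt 5) / 2) ∨
  (n = 8 ∧ m = 6 ∧ ρ = (1 + Complex.I) * (1 - Complex.I / (Real.sqrt 2 : ℝ)) ∧
    s = expPi (1 / 2) + expPi (1 / 12) + expPi (-7 / 12) ∧
    σ = Real.sqrt (2 + Real.sqrt 2)) ∨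
  (3 ≤ n ∧ n = m ∧ ρ = 2 * expPi (1 / n) * (Real.cos (Real.pi / n) : ℝ) ∧
    s = expPi (2 / n) ∧ σ = 2 * Real.cos (Real.pi / n))

end

/-!
The symmetry `J = R₁⁻¹S` satisfies `J R₁ = R₂ J` and `J² = R₃`, so it maps the normalised polar
vector `v₃` to `ε u v₃` with `ε = ±1` and `v₁` to a multiple of `v₂`; as `J` is an isometry,
`σ = τ` and `σ² = ρ + ρ̄`. If `ε = -1` then `tr S = ρ - 1`; if `ε = 1` this becomes true after
changing the sign of two eigenvalues of `S`. Since `S` has finite order and determinant one,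
`ρ - 1 = a + b + c` for roots of unity with `abc = 1`.

Two complex reflections generate a group acting on the plane of their polar vectors, where the braid
relation of length `l` is the vanishing of a Chebyshev polynomial. This gives `|ρ| = 2 cos (kπ/m)`
and `σ = 2 cos (lπ/n)`. The equation `σ² = ρ + ρ̄` then becomes the relation
`a + a⁻¹ + b + b⁻¹ + c + c⁻¹ = z + z⁻¹` between eight roots of unity, where `z = e^{2πil/n}`.
Galois conjugation splits such a relation over the cosets of the `q`-th roots of unity, which lowers
the order of the roots one prime at a time until only finitely many solutions remain besides the
families in which one of `a`, `b`, `c` is `z` or `z⁻¹`. In each of them `z + z⁻¹ = σ² - 2` and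
`|a + b + c + 1|² = |ρ|²` determine `n` and `m`.
-/

/-! ### Relations between roots of unity -/

/- The minimal polynomial of a primitive `Q`-th root of unity `ζ` over `ℤ` is also that of `ζ ^ t`,
so it divides the polynomial obtained by writing the relation in powers of `ζ`. -/
theorem sum_pow_eq_zero_of_coprime {ι : Type*} [Fintype ι] {Q t : ℕ} (hQ : Q ≠ 0)
    (ht : t.Coprime Q) (f : ι → ℤ) (x : ι → ℂ) (hx : ∀ i, x i ^ Q = 1)
    (h : ∑ i, (f i : ℂ) * x i = 0) : ∑ i, (f i : ℂ) * x i ^ t = 0 := by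
  have : NeZero Q := ⟨hQ⟩
  have hζ := Complex.isPrimitiveRoot_exp Q hQ
  set ζ := Complex.exp (2 * Real.pi * Complex.I / Q)
  choose e _ he using fun i => hζ.eq_pow_of_pow_eq_one (hx i)
  let P : Polynomial ℤ := ∑ i, Polynomial.C (f i) * Polynomial.X ^ e i
  have aeval_P (w : ℂ) : Polynomial.aeval w P = ∑ i, (f i : ℂ) * w ^ e i := by simp [P]
  have hdvd : minpoly ℤ ζ ∣ P :=
    minpoly.isIntegrallyClosed_dvd (hζ.isIntegral (Nat.pos_of_ne_zero hQ))
      (by simp only [aeval_P, he, h])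
  rw [← Polynomial.cyclotomic_eq_minpoly hζ (Nat.pos_of_ne_zero hQ),
    Polynomial.cyclotomic_eq_minpoly (hζ.pow_of_coprime t ht) (Nat.pos_of_ne_zero hQ)] at hdvd
  obtain ⟨g, hg⟩ := hdvd
  calc ∑ i, (f i : ℂ) * x i ^ t = Polynomial.aeval (ζ ^ t) P := by
        simp only [aeval_P, ← he, ← pow_mul, mul_comm t]
    _ = 0 := by rw [hg, map_mul, minpoly.aeval, zero_mul]

theorem geom_sum_of_pow_eq_one {K : Type*} [Field K] [DecidableEq K] {w : K} {d : ℕ}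
    (hw : w ^ d = 1) : ∑ j ∈ Finset.range d, w ^ j = if w = 1 then (d : K) else 0 := by
  split_ifs with h
  · simp [h]
  · rw [geom_sum_eq h, hw, sub_self, zero_div]

/- The `q`-th power of a `(q * d)`-th root of unity is a label for its coset modulo the `q`-th roots
of unity, and the partial sums over these cosets are recovered by Fourier inversion. -/
theorem card_mul_sum_coset {ι K : Type*} [Fintype ι] [Field K] [DecidableEq K] {d q : ℕ}
    (f x : ι → K) (hx : ∀ i, x i ^ (q * d) = 1) {κ : K} (hκ : κ ^ d = 1) :
    (d : K) * ∑ i, (if x i ^ q = κ then f i * x i else 0) =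
      ∑ j ∈ Finset.range d, κ⁻¹ ^ j * ∑ i, f i * x i ^ (1 + q * j) := by
  rcases eq_or_ne d 0 with rfl | hd
  · simp
  have hκ0 : κ ≠ 0 := by rintro rfl; simp [hd] at hκ
  have inner_sum (i : ι) : ∑ j ∈ Finset.range d, (κ⁻¹ * x i ^ q) ^ j =
      if x i ^ q = κ then (d : K) else 0 := by
    rw [geom_sum_of_pow_eq_one (by rw [mul_pow, inv_pow, hκ, ← pow_mul, hx, inv_one, one_mul])]
    simp only [inv_mul_eq_one₀ hκ0, eq_comm]
  simp_rw [Finset.mul_sum]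
  rw [Finset.sum_comm]
  refine Finset.sum_congr rfl fun i _ => ?_
  calc (d : K) * (if x i ^ q = κ then f i * x i else 0)
      = f i * x i * ∑ j ∈ Finset.range d, (κ⁻¹ * x i ^ q) ^ j := by
        rw [inner_sum]; split_ifs <;> ring
    _ = ∑ j ∈ Finset.range d, κ⁻¹ ^ j * (f i * x i ^ (1 + q * j)) := by
        rw [Finset.mul_sum]
        exact Finset.sum_congr rfl fun j _ => by ring

theorem coprime_one_add_mul_of_dvd_pow {d q : ℕ} (k j : ℕ) (h : d ∣ q ^ k) :
    (1 + q * j).Coprime d :=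
  ((Nat.coprime_add_mul_left_left 1 q j).2 (Nat.coprime_one_left q)).pow_right k
    |>.coprime_dvd_right h

theorem sum_coset_eq_zero {ι : Type*} [Fintype ι] {d q k : ℕ} (hd : d ≠ 0) (hq : q ≠ 0)
    (hdq : d ∣ q ^ k) (f : ι → ℤ) (x : ι → ℂ) (hx : ∀ i, x i ^ (q * d) = 1)
    (h : ∑ i, (f i : ℂ) * x i = 0) {κ : ℂ} (hκ : κ ^ d = 1) :
    ∑ i, (if x i ^ q = κ then (f i : ℂ) * x i else 0) = 0 := by
  have hsum := card_mul_sum_coset (fun i => (f i : ℂ)) x hx hκ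
  rw [Finset.sum_eq_zero (s := Finset.range d) fun j _ => ?_] at hsum
  · exact (mul_eq_zero.1 hsum).resolve_left (Nat.cast_ne_zero.2 hd)
  · rw [sum_pow_eq_zero_of_coprime (mul_ne_zero hq hd) _ f x hx h, mul_zero]
    exact Nat.Coprime.mul_right
      ((Nat.coprime_add_mul_left_left 1 q j).2 (Nat.coprime_one_left q))
      (coprime_one_add_mul_of_dvd_pow k j hdq)

/- Only the conjugation exponent `1 + q * r` divisible by `p` contributes to the Fourier sum. -/
theorem exists_sum_coset_eq {ι : Type*} [Fintype ι] {p q : ℕ} (hp : p.Prime) (hq : q ≠ 0)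
    (hpq : p.Coprime q) (f : ι → ℤ) (x : ι → ℂ) (hx : ∀ i, x i ^ (q * p) = 1)
    (h : ∑ i, (f i : ℂ) * x i = 0) :
    ∃ (C : ℂ) (r : ℕ), ∀ κ : ℂ, κ ^ p = 1 →
      ∑ i, (if x i ^ q = κ then (f i : ℂ) * x i else 0) = C * κ⁻¹ ^ r := by
  have : Fact p.Prime := ⟨hp⟩
  have hq0 : (q : ZMod p) ≠ 0 := by
    rw [Ne, ZMod.natCast_eq_zero_iff]
    exact hp.coprime_iff_not_dvd.1 hpq
  obtain ⟨r, hr, hrq⟩ : ∃ r < p, (r : ZMod p) = -(q : ZMod p)⁻¹ :=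
    ⟨_, ZMod.val_lt _, ZMod.natCast_zmod_val _⟩
  refine ⟨(∑ i, (f i : ℂ) * x i ^ (1 + q * r)) / p, r, fun κ hκ => ?_⟩
  have hsum := card_mul_sum_coset (fun i => (f i : ℂ)) x hx hκ
  rw [Finset.sum_eq_single_of_mem r (Finset.mem_range.2 hr) fun j hj hjr => ?_] at hsum
  · rw [div_mul_eq_mul_div, eq_div_iff (Nat.cast_ne_zero.2 hp.ne_zero)]
    linear_combination hsum
  · rw [sum_pow_eq_zero_of_coprime (mul_ne_zero hq hp.ne_zero) _ f x hx h, mul_zero]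
    refine Nat.Coprime.mul_right
      ((Nat.coprime_add_mul_left_left 1 q j).2 (Nat.coprime_one_left q))
      (hp.coprime_iff_not_dvd.2 fun hdvd => hjr ?_).symm
    rw [← ZMod.natCast_eq_zero_iff, Nat.cast_add, Nat.cast_mul, Nat.cast_one] at hdvd
    have hjr' : (j : ZMod p) = r := by
      rw [hrq, eq_neg_iff_add_eq_zero]
      field_simp
      linear_combination hdvd
    rwa [ZMod.natCast_eq_natCast_iff', Nat.mod_eq_of_lt (Finset.mem_range.1 hj),
      Nat.mod_eq_of_lt hr] at hjr'

/-- The possible pairs consisting of the trace `t = z + z⁻¹` and the value `N = |a + b + c|²` for a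
nontrivial solution in roots of unity of `a + b + c + a⁻¹ + b⁻¹ + c⁻¹ = z + z⁻¹`, `abc = 1`. In the
geometric application `t = σ² - 2` and `N = |ρ - 1|²`. -/
def IsTracePair (t N : ℂ) : Prop :=
  N = 1 ∨ (t = 0 ∧ N = 0) ∨ (t ^ 2 = 2 ∧ N = 2 - t) ∨ (t = -1 ∧ N = 2) ∨
    (t = -1 ∧ (N - 2) ^ 2 + (N - 2) = 1) ∨ (t ^ 2 + t = 1 ∧ N = t ^ 2)

/-- The conclusion of the classification for the solution `(a, b, c; z)` of the trace equation. -/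
def IsAdmissible (a b c z : ℂ) : Prop :=
  IsTracePair (z + z⁻¹) ((a + b + c) * (a⁻¹ + b⁻¹ + c⁻¹))

/-- Solutions of the trace equation in `Q`-th roots of unity, apart from the trivial `z = ±1`. -/
structure IsTraceRelation (Q : ℕ) (a b c z : ℂ) : Prop where
  ne_zero : Q ≠ 0
  pow_a : a ^ Q = 1
  pow_b : b ^ Q = 1
  pow_c : c ^ Q = 1
  pow_z : z ^ Q = 1
  prod_eq_one : a * b * c = 1
  sum_eq : a + a⁻¹ + (b + b⁻¹) + (c + c⁻¹) = z + z⁻¹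
  z_ne_one : z ≠ 1
  z_ne_neg_one : z ≠ -1

section

variable {Q q d : ℕ} {a b c z κ x : ℂ}

namespace IsAdmissible

theorem rotate (h : IsAdmissible b c a z) : IsAdmissible a b c z := by
  unfold IsAdmissible at h ⊢
  rwa [add_rotate, add_rotate, add_rotate b⁻¹, add_rotate c⁻¹] at h

theorem swap (h : IsAdmissible a c b z) : IsAdmissible a b c z := by
  unfold IsAdmissible at h ⊢
  rwa [add_right_comm, add_right_comm a⁻¹] at h

theorem inv_z (h : IsAdmissible a b c z⁻¹) : IsAdmissible a b c z := by
  rwa [IsAdmissible, inv_inv, add_comm] at h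

end IsAdmissible

namespace IsTraceRelation

theorem rotate (h : IsTraceRelation Q a b c z) : IsTraceRelation Q b c a z :=
  ⟨h.ne_zero, h.pow_b, h.pow_c, h.pow_a, h.pow_z, by linear_combination h.prod_eq_one,
    by linear_combination h.sum_eq, h.z_ne_one, h.z_ne_neg_one⟩

theorem swap (h : IsTraceRelation Q a b c z) : IsTraceRelation Q a c b z :=
  ⟨h.ne_zero, h.pow_a, h.pow_c, h.pow_b, h.pow_z, by linear_combination h.prod_eq_one,
    by linear_combination h.sum_eq, h.z_ne_one, h.z_ne_neg_one⟩

theorem inv_z (h : IsTraceRelation Q a b c z) : IsTraceRelation Q a b c z⁻¹ :=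
  ⟨h.ne_zero, h.pow_a, h.pow_b, h.pow_c, by rw [inv_pow, h.pow_z, inv_one], h.prod_eq_one,
    by rw [h.sum_eq, inv_inv, add_comm], by simpa using h.z_ne_one,
    by simpa [inv_eq_iff_eq_inv] using h.z_ne_neg_one⟩

theorem ne_zero_a (h : IsTraceRelation Q a b c z) : a ≠ 0 :=
  (IsUnit.of_pow_eq_one h.pow_a h.ne_zero).ne_zero

theorem ne_zero_b (h : IsTraceRelation Q a b c z) : b ≠ 0 :=
  h.rotate.ne_zero_a

theorem ne_zero_c (h : IsTraceRelation Q a b c z) : c ≠ 0 :=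
  h.rotate.rotate.ne_zero_a

theorem ne_zero_z (h : IsTraceRelation Q a b c z) : z ≠ 0 :=
  (IsUnit.of_pow_eq_one h.pow_z h.ne_zero).ne_zero

theorem inv_c (h : IsTraceRelation Q a b c z) : c⁻¹ = a * b :=
  inv_eq_of_mul_eq_one_left h.prod_eq_one

theorem add_inv_ne_neg_two (h : IsTraceRelation Q a b c z) : z + z⁻¹ ≠ -2 := fun hz =>
  h.z_ne_neg_one <| by
    have := h.ne_zero_z
    field_simp at hz
    exact eq_neg_of_add_eq_zero_left (pow_eq_zero_iff two_ne_zero |>.1 (by linear_combination hz))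

theorem c_ne_neg_one_of_add_eq_zero (h : IsTraceRelation Q a b c z)
    (hab : a + a⁻¹ + (b + b⁻¹) = 0) : c ≠ -1 := by
  rintro rfl
  exact h.add_inv_ne_neg_two (by rw [← h.sum_eq, hab]; norm_num)

theorem isAdmissible_of_sum_eq (h : IsTraceRelation Q a b c z) (hz : a + b + c = z) :
    IsAdmissible a b c z := by
  have hz' : a⁻¹ + b⁻¹ + c⁻¹ = z⁻¹ := by linear_combination h.sum_eq - hz
  exact Or.inl (by rw [hz, hz', mul_inv_cancel₀ h.ne_zero_z])

theorem isAdmissible_of_add_eq_zero (h : IsTraceRelation Q a b c z)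
    (hab : a + a⁻¹ + (b + b⁻¹) = 0) : IsAdmissible a b c z := by
  have ha := h.ne_zero_a
  have hb := h.ne_zero_b
  have hfac : (a + b) * (a * b + 1) = 0 := by field_simp at hab; linear_combination hab
  rcases mul_eq_zero.1 hfac with hsum | hprod
  · have hinv : a⁻¹ + b⁻¹ = 0 := by linear_combination hab - hsum
    exact Or.inl (by rw [hsum, hinv, zero_add, zero_add, mul_inv_cancel₀ h.ne_zero_c])
  · refine absurd ?_ (h.c_ne_neg_one_of_add_eq_zero hab)
    rw [← inv_inv c, h.inv_c, eq_neg_of_add_eq_zero_left hprod, inv_neg, inv_one]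

theorem add_inv_ne (h : IsTraceRelation Q a b c z) (hc : c + c⁻¹ = 0) : a + b⁻¹ ≠ z := by
  intro hz
  have hz' : a⁻¹ + b = z⁻¹ := by linear_combination h.sum_eq - hc - hz
  have hone : (a + b⁻¹) * (a⁻¹ + b) = 1 := by rw [hz, hz', mul_inv_cancel₀ h.ne_zero_z]
  have hexp : (a + b⁻¹) * (a⁻¹ + b) = 2 + (c + c⁻¹) := by
    have ha := h.ne_zero_a
    have hb := h.ne_zero_b
    rw [← inv_inv c, h.inv_c]
    field_simp
    ring
  rw [hexp, hc] at hone
  norm_num at hone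

theorem isAdmissible_of_add_eq (h : IsTraceRelation Q a b c z) (hc : c + c⁻¹ = 0)
    (hz : a + b = z) : IsAdmissible a b c z := by
  have hz' : a⁻¹ + b⁻¹ = z⁻¹ := by linear_combination h.sum_eq - hc - hz
  have hz0 := h.ne_zero_z
  have hc_inv : c⁻¹ = z ^ 2 := by
    have ha := h.ne_zero_a
    have hb := h.ne_zero_b
    have hab : z * z⁻¹ * (a * b) = z ^ 2 := by rw [← hz', ← hz]; field_simp; ring
    rw [h.inv_c, ← hab, mul_inv_cancel₀ hz0, one_mul]
  have hc' : c = -z ^ 2 := by linear_combination hc - hc_inv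
  have hz4 : z ^ 4 = -1 := by
    have := mul_inv_cancel₀ h.ne_zero_c
    rw [hc_inv, hc'] at this
    linear_combination -this
  refine Or.inr (Or.inr (Or.inl ⟨?_, ?_⟩))
  · field_simp
    linear_combination hz4
  · rw [hz, hz', hc_inv, hc']
    field_simp
    linear_combination (1 - z) * hz4

end IsTraceRelation

/-- The part of `x + x⁻¹` lying in the coset `{y | y ^ q = κ}` of the group of `q`-th roots of
unity. -/
noncomputable def cosetPart (q : ℕ) (κ x : ℂ) : ℂ :=
  (if x ^ q = κ then x else 0) + if x⁻¹ ^ q = κ then x⁻¹ else 0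

theorem inv_pow_eq_iff : x⁻¹ ^ q = κ ↔ x ^ q = κ⁻¹ := by
  rw [inv_pow, inv_eq_iff_eq_inv]

theorem cosetPart_inv : cosetPart q κ x⁻¹ = cosetPart q κ x := by
  rw [cosetPart, cosetPart, inv_inv, add_comm]

theorem cosetPart_of_eq (hx : x ^ q = κ) (hκ : κ ≠ κ⁻¹) : cosetPart q κ x = x := by
  rw [cosetPart, if_pos hx, if_neg (by rwa [inv_pow_eq_iff, hx]), add_zero]

theorem cosetPart_of_eq_inv (hx : x ^ q = κ⁻¹) (hκ : κ ≠ κ⁻¹) : cosetPart q κ x = x⁻¹ := by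
  rw [← cosetPart_inv, cosetPart_of_eq (inv_pow_eq_iff.2 hx) hκ]

theorem cosetPart_of_ne (hx : x ^ q ≠ κ) (hx' : x ^ q ≠ κ⁻¹) : cosetPart q κ x = 0 := by
  rw [cosetPart, if_neg hx, if_neg (mt inv_pow_eq_iff.1 hx'), add_zero]

theorem cosetPart_of_pow_eq_one (hx : x ^ q = 1) (hκ : κ ≠ 1) : cosetPart q κ x = 0 :=
  cosetPart_of_ne (by rwa [hx, ne_comm]) (by rwa [hx, Ne, eq_comm, inv_eq_one])

theorem cosetPart_of_eq_self_inv (hx : x ^ q = κ) (hκ : κ = κ⁻¹) :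
    cosetPart q κ x = x + x⁻¹ := by
  rw [cosetPart, if_pos hx, if_pos (inv_pow_eq_iff.2 (hx.trans hκ))]

/-- The trace equation holds separately in each coset of the `q`-th roots of unity inside the
`(q * d)`-th roots of unity. -/
def SplitsAlong (d q : ℕ) (a b c z : ℂ) : Prop :=
  ∀ κ : ℂ, κ ^ d = 1 → cosetPart q κ a + cosetPart q κ b + cosetPart q κ c = cosetPart q κ z

namespace SplitsAlong

theorem rotate (h : SplitsAlong d q a b c z) : SplitsAlong d q b c a z := fun κ hκ => by
  rw [← h κ hκ, add_rotate, add_rotate]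

theorem swap (h : SplitsAlong d q a b c z) : SplitsAlong d q a c b z := fun κ hκ => by
  rw [← h κ hκ, add_right_comm]

theorem inv_z (h : SplitsAlong d q a b c z) : SplitsAlong d q a b c z⁻¹ := fun κ hκ => by
  rw [h κ hκ, cosetPart_inv]

end SplitsAlong

namespace IsTraceRelation

/-- The eight roots of unity occurring in the trace equation. -/
noncomputable def term (a b c z : ℂ) : Fin 8 → ℂ := ![a, a⁻¹, b, b⁻¹, c, c⁻¹, z, z⁻¹]

/-- The coefficients of the trace equation, written as `∑ i, coeff i * term a b c z i = 0`. -/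
def coeff : Fin 8 → ℤ := ![1, 1, 1, 1, 1, 1, -1, -1]

theorem sum_coeff_term (a b c z : ℂ) {g : ℂ → ℂ → ℂ} (hg : ∀ x, g (-1) x = -g 1 x) :
    ∑ i, g (coeff i) (term a b c z i) =
      g 1 a + g 1 a⁻¹ + (g 1 b + g 1 b⁻¹) + (g 1 c + g 1 c⁻¹) - (g 1 z + g 1 z⁻¹) := by
  simp only [coeff, term, Fin.sum_univ_succ, Matrix.cons_val_zero, Matrix.cons_val_succ,
    Int.cast_one, Int.cast_neg, hg, Finset.univ_eq_empty, Finset.sum_empty]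
  ring

theorem sum_coeff_mul_term (h : IsTraceRelation Q a b c z) :
    ∑ i, (coeff i : ℂ) * term a b c z i = 0 := by
  rw [sum_coeff_term a b c z (g := fun n x => n * x) (fun x => neg_mul 1 x)]
  linear_combination h.sum_eq

theorem sum_coset_term (a b c z : ℂ) (q : ℕ) (κ : ℂ) :
    ∑ i, (if term a b c z i ^ q = κ then (coeff i : ℂ) * term a b c z i else 0) =
      cosetPart q κ a + cosetPart q κ b + cosetPart q κ c - cosetPart q κ z := by
  rw [sum_coeff_term a b c z (g := fun n x => if x ^ q = κ then n * x else 0)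
    (fun x => by split_ifs <;> ring)]
  simp only [one_mul, cosetPart]

theorem term_pow (h : IsTraceRelation Q a b c z) (i : Fin 8) : term a b c z i ^ Q = 1 := by
  fin_cases i <;> simp [term, h.pow_a, h.pow_b, h.pow_c, h.pow_z]

theorem splitsAlong {k : ℕ} (h : IsTraceRelation (q * d) a b c z) (hdq : d ∣ q ^ k) :
    SplitsAlong d q a b c z := fun κ hκ => by
  rw [← sub_eq_zero, ← sum_coset_term]
  exact sum_coset_eq_zero (right_ne_zero_of_mul h.ne_zero) (left_ne_zero_of_mul h.ne_zero) hdq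
    _ _ h.term_pow h.sum_coeff_mul_term hκ

theorem exists_cosetPart_eq {p : ℕ} (hp : p.Prime) (hpq : p.Coprime q)
    (h : IsTraceRelation (q * p) a b c z) : ∃ (C : ℂ) (r : ℕ), ∀ κ : ℂ, κ ^ p = 1 →
      cosetPart q κ a + cosetPart q κ b + cosetPart q κ c - cosetPart q κ z = C * κ⁻¹ ^ r := by
  simp only [← sum_coset_term]
  exact exists_sum_coset_eq hp (left_ne_zero_of_mul h.ne_zero) hpq _ _ h.term_pow
    h.sum_coeff_mul_term

end IsTraceRelation

theorem ne_inv_of_odd (hd : Odd d) (hx : x ^ d = 1) (hx1 : x ≠ 1) : x ≠ x⁻¹ := by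
  intro hinv
  have hx0 : x ≠ 0 := by rintro rfl; simp [hd.pos.ne'] at hx
  have hgcd : x ^ Nat.gcd 2 d = 1 :=
    pow_gcd_eq_one.2 ⟨by rw [pow_two, mul_eq_one_iff_eq_inv₀ hx0]; exact hinv, hx⟩
  rw [(Nat.coprime_two_left).2 hd, pow_one] at hgcd
  exact hx1 hgcd

namespace IsTraceRelation

theorem coset_a (h : IsTraceRelation (q * d) a b c z) : (a ^ q) ^ d = 1 := by
  rw [← pow_mul, h.pow_a]

theorem coset_z (h : IsTraceRelation (q * d) a b c z) : (z ^ q) ^ d = 1 := by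
  rw [← pow_mul, h.pow_z]

theorem coset_c (h : IsTraceRelation Q a b c z) : c ^ q = (a ^ q * b ^ q)⁻¹ := by
  rw [← mul_pow, ← h.inv_c, inv_pow, inv_inv]

theorem coset_c_eq_one (h : IsTraceRelation Q a b c z) (hab : b ^ q = (a ^ q)⁻¹) :
    c ^ q = 1 := by
  rw [h.coset_c, hab, mul_inv_cancel₀ (pow_ne_zero q h.ne_zero_a), inv_one]

theorem isAdmissible_of_coset_eq (hd : Odd d) (h : IsTraceRelation (q * d) a b c z)
    (hs : SplitsAlong d q a b c z) (ha : a ^ q ≠ 1) (hb : b ^ q = a ^ q)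
    (hz : z ^ q = 1 ∨ z ^ q = a ^ q) : IsAdmissible a b c z := by
  have ha_inv := ne_inv_of_odd hd h.coset_a ha
  by_cases hc : c ^ q = a ^ q
  · have hsum := hs (a ^ q) h.coset_a
    rw [cosetPart_of_eq rfl ha_inv, cosetPart_of_eq hb ha_inv, cosetPart_of_eq hc ha_inv] at hsum
    rcases hz with hz | hz
    · rw [cosetPart_of_pow_eq_one hz ha] at hsum
      have hsum_inv := hs (a ^ q)⁻¹ (by rw [inv_pow, h.coset_a, inv_one])
      rw [cosetPart_of_pow_eq_one hz (by rwa [Ne, inv_eq_one]),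
        cosetPart_of_eq_inv (inv_inv _).symm (by rwa [inv_inv, ne_comm]),
        cosetPart_of_eq_inv (by rwa [inv_inv]) (by rwa [inv_inv, ne_comm]),
        cosetPart_of_eq_inv (by rwa [inv_inv]) (by rwa [inv_inv, ne_comm])] at hsum_inv
      refine Or.inr (Or.inl ⟨?_, by rw [hsum, zero_mul]⟩)
      linear_combination hsum + hsum_inv - h.sum_eq
    · exact h.isAdmissible_of_sum_eq (by rw [hsum, cosetPart_of_eq hz ha_inv])
  · have ha0 : a ^ q ≠ 0 := pow_ne_zero q h.ne_zero_a
    have hc_eq : c ^ q = (a ^ q)⁻¹ * (a ^ q)⁻¹ := by rw [h.coset_c, hb, mul_inv]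
    have hc1 : c ^ q ≠ 1 := by
      rw [hc_eq, ← mul_inv, Ne, inv_eq_one, mul_eq_one_iff_eq_inv₀ ha0]
      exact ha_inv
    have hac : a ^ q ≠ (c ^ q)⁻¹ := by
      rw [hc_eq, ← mul_inv, inv_inv]
      simpa [ha0] using ha
    have hcz : cosetPart q (c ^ q) z = 0 := by
      rcases hz with hz | hz
      · exact cosetPart_of_pow_eq_one hz hc1
      · exact cosetPart_of_ne (hz ▸ Ne.symm hc) (hz ▸ hac)
    have hsum := hs (c ^ q) h.rotate.rotate.coset_a
    rw [cosetPart_of_ne (Ne.symm hc) hac, cosetPart_of_ne (hb ▸ Ne.symm hc) (hb ▸ hac),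
      cosetPart_of_eq rfl (ne_inv_of_odd hd h.rotate.rotate.coset_a hc1), hcz] at hsum
    exact absurd (by simpa using hsum) h.ne_zero_c

theorem isAdmissible_of_coset_eq_inv (hd : Odd d) (h : IsTraceRelation (q * d) a b c z)
    (hs : SplitsAlong d q a b c z) (ha : a ^ q ≠ 1) (hb : b ^ q = (a ^ q)⁻¹)
    (hz : z ^ q = 1 ∨ z ^ q = a ^ q) : IsAdmissible a b c z := by
  have ha_inv := ne_inv_of_odd hd h.coset_a ha
  have hsum := hs (a ^ q) h.coset_a
  rw [cosetPart_of_eq rfl ha_inv, cosetPart_of_eq_inv hb ha_inv,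
    cosetPart_of_pow_eq_one (h.coset_c_eq_one hb) ha, add_zero] at hsum
  have hsum_inv := hs (a ^ q)⁻¹ (by rw [inv_pow, h.coset_a, inv_one])
  rw [cosetPart_of_pow_eq_one (h.coset_c_eq_one hb) (by rwa [Ne, inv_eq_one]), add_zero,
    cosetPart_of_eq_inv (inv_inv _).symm (by rwa [inv_inv, ne_comm]),
    cosetPart_of_eq hb (by rwa [inv_inv, ne_comm])] at hsum_inv
  exfalso
  rcases hz with hz | hz
  · rw [cosetPart_of_pow_eq_one hz ha] at hsum
    rw [cosetPart_of_pow_eq_one hz (by rwa [Ne, inv_eq_one])] at hsum_inv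
    refine h.c_ne_neg_one_of_add_eq_zero (by linear_combination hsum + hsum_inv) ?_
    have hb0 := h.ne_zero_b
    have hab : a * b = -1 := by
      field_simp at hsum
      linear_combination hsum
    rw [← inv_inv c, h.inv_c, hab, inv_neg, inv_one]
  · rw [cosetPart_of_eq hz ha_inv] at hsum
    rw [cosetPart_of_eq_inv (by rwa [inv_inv]) (by rwa [inv_inv, ne_comm])] at hsum_inv
    exact h.add_inv_ne (by linear_combination h.sum_eq - hsum - hsum_inv) hsum

theorem isAdmissible_of_coset_ne (hd : Odd d) (h : IsTraceRelation (q * d) a b c z)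
    (hs : SplitsAlong d q a b c z) (ha : a ^ q ≠ 1) (hz : z ^ q = 1 ∨ z ^ q = a ^ q) :
    IsAdmissible a b c z := by
  by_cases hb : b ^ q = a ^ q
  · exact h.isAdmissible_of_coset_eq hd hs ha hb hz
  by_cases hb' : b ^ q = (a ^ q)⁻¹
  · exact h.isAdmissible_of_coset_eq_inv hd hs ha hb' hz
  by_cases hc : c ^ q = a ^ q
  · exact (h.swap.isAdmissible_of_coset_eq hd hs.swap ha hc hz).swap
  by_cases hc' : c ^ q = (a ^ q)⁻¹
  · exact (h.swap.isAdmissible_of_coset_eq_inv hd hs.swap ha hc' hz).swap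
  have ha_inv := ne_inv_of_odd hd h.coset_a ha
  have hsum := hs (a ^ q) h.coset_a
  rw [cosetPart_of_eq rfl ha_inv, cosetPart_of_ne hb hb', cosetPart_of_ne hc hc', add_zero,
    add_zero] at hsum
  rcases hz with hz | hz
  · rw [cosetPart_of_pow_eq_one hz ha] at hsum
    exact absurd hsum h.ne_zero_a
  · rw [cosetPart_of_eq hz ha_inv] at hsum
    have hbc : b + b⁻¹ + (c + c⁻¹) = 0 := by
      have hsum_eq := h.sum_eq
      rw [hsum] at hsum_eq
      linear_combination hsum_eq
    exact (h.rotate.isAdmissible_of_add_eq_zero hbc).rotate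

theorem isAdmissible_of_coset_eq_or_eq_inv (hd : Odd d) (h : IsTraceRelation (q * d) a b c z)
    (hs : SplitsAlong d q a b c z) (hz1 : z ^ q ≠ 1) (ha : z ^ q = a ^ q ∨ z⁻¹ ^ q = a ^ q) :
    IsAdmissible a b c z := by
  rcases ha with ha | ha
  · exact h.isAdmissible_of_coset_ne hd hs (ha ▸ hz1) (.inr ha)
  · refine (h.inv_z.isAdmissible_of_coset_ne hd hs.inv_z ?_ (.inr ha)).inv_z
    rwa [← ha, inv_pow, Ne, inv_eq_one]

theorem isAdmissible_or_descend (hd : Odd d) (h : IsTraceRelation (q * d) a b c z)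
    (hs : SplitsAlong d q a b c z) : IsAdmissible a b c z ∨ IsTraceRelation q a b c z := by
  rw [or_iff_not_imp_left]
  intro hadm
  have hz : z ^ q = 1 := by
    by_contra hz
    have hz_inv := ne_inv_of_odd hd h.coset_z hz
    have hne {a b c : ℂ} (h : IsTraceRelation (q * d) a b c z) (hs : SplitsAlong d q a b c z)
        (hadm : ¬IsAdmissible a b c z) : cosetPart q (z ^ q) a = 0 := by
      refine cosetPart_of_ne (fun ha => hadm ?_) (fun ha => hadm ?_)
      · exact h.isAdmissible_of_coset_eq_or_eq_inv hd hs hz (.inl ha.symm)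
      · exact h.isAdmissible_of_coset_eq_or_eq_inv hd hs hz (.inr (by rw [inv_pow, ha]))
    have hsum := hs (z ^ q) h.coset_z
    rw [hne h hs hadm, hne h.rotate hs.rotate (mt .rotate hadm),
      hne h.rotate.rotate hs.rotate.rotate (mt .rotate (mt .rotate hadm)),
      cosetPart_of_eq rfl hz_inv] at hsum
    exact h.ne_zero_z (by simpa using hsum.symm)
  have hne {a b c : ℂ} (h : IsTraceRelation (q * d) a b c z) (hs : SplitsAlong d q a b c z)
      (hadm : ¬IsAdmissible a b c z) : a ^ q = 1 :=
    of_not_not fun ha => hadm (h.isAdmissible_of_coset_ne hd hs ha (.inl hz))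
  exact ⟨left_ne_zero_of_mul h.ne_zero, hne h hs hadm, hne h.rotate hs.rotate (mt .rotate hadm),
    hne h.rotate.rotate hs.rotate.rotate (mt .rotate (mt .rotate hadm)), hz, h.prod_eq_one,
    h.sum_eq, h.z_ne_one, h.z_ne_neg_one⟩

end IsTraceRelation

/-- The trace equation holds in the cosets of the `q`-th roots of unity up to the error
`C * κ⁻¹ ^ r` in the coset labelled `κ`, the form the defect takes when `p` is a prime not
dividing `q`. -/
def SplitsUpTo (p q : ℕ) (C : ℂ) (r : ℕ) (a b c z : ℂ) : Prop :=
  ∀ κ : ℂ, κ ^ p = 1 →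
    cosetPart q κ a + cosetPart q κ b + cosetPart q κ c - cosetPart q κ z = C * κ⁻¹ ^ r

namespace SplitsUpTo

variable {p r : ℕ} {C : ℂ}

theorem rotate (h : SplitsUpTo p q C r a b c z) : SplitsUpTo p q C r b c a z := fun κ hκ => by
  rw [← h κ hκ, add_rotate, add_rotate]

theorem swap (h : SplitsUpTo p q C r a b c z) : SplitsUpTo p q C r a c b z := fun κ hκ => by
  rw [← h κ hκ, add_right_comm]

theorem inv_z (h : SplitsUpTo p q C r a b c z) : SplitsUpTo p q C r a b c z⁻¹ := fun κ hκ => by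
  rw [← h κ hκ, cosetPart_inv]

theorem splitsAlong (h : SplitsUpTo p q 0 r a b c z) : SplitsAlong p q a b c z := fun κ hκ => by
  rw [← sub_eq_zero, h κ hκ, zero_mul]

theorem cover (h : SplitsUpTo p q C r a b c z) (hp : p ≠ 0) (hC : C ≠ 0) (hκ : κ ^ p = 1) :
    (κ = a ^ q ∨ κ = (a ^ q)⁻¹) ∨ (κ = b ^ q ∨ κ = (b ^ q)⁻¹) ∨ (κ = c ^ q ∨ κ = (c ^ q)⁻¹) ∨
      κ = z ^ q ∨ κ = (z ^ q)⁻¹ := by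
  by_contra! hne
  obtain ⟨ha, hb, hc, hz⟩ := hne
  have hzero {x : ℂ} (hx : κ ≠ x ^ q ∧ κ ≠ (x ^ q)⁻¹) : cosetPart q κ x = 0 :=
    cosetPart_of_ne hx.1.symm fun he => hx.2 (by rw [he, inv_inv])
  have hκ0 : κ ≠ 0 := (IsUnit.of_pow_eq_one hκ hp).ne_zero
  have hsum := h κ hκ
  rw [hzero ha, hzero hb, hzero hc, hzero hz] at hsum
  exact mul_ne_zero hC (pow_ne_zero r (inv_ne_zero hκ0)) (by rw [← hsum]; ring)

theorem le_eight (h : SplitsUpTo p q C r a b c z) (hp : p ≠ 0) (hC : C ≠ 0) : p ≤ 8 := by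
  have hsub : Polynomial.nthRootsFinset p (1 : ℂ) ⊆ {a ^ q, (a ^ q)⁻¹, b ^ q, (b ^ q)⁻¹, c ^ q,
      (c ^ q)⁻¹, z ^ q, (z ^ q)⁻¹} := fun κ hκ => by
    rw [Polynomial.mem_nthRootsFinset (Nat.pos_of_ne_zero hp)] at hκ
    simpa only [Finset.mem_insert, Finset.mem_singleton, or_assoc] using h.cover hp hC hκ
  calc p = (Polynomial.nthRootsFinset p (1 : ℂ)).card :=
        (Complex.isPrimitiveRoot_exp p hp).card_nthRootsFinset.symm
    _ ≤ _ := Finset.card_le_card hsub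
    _ ≤ 8 := (Finset.card_insert_le _ _).trans <| Nat.succ_le_succ <|
        (Finset.card_insert_le _ _).trans <| Nat.succ_le_succ Finset.card_le_six

end SplitsUpTo

theorem exists_stdAddChar_eq {p : ℕ} [NeZero p] (hx : x ^ p = 1) :
    ∃ k : ZMod p, ZMod.stdAddChar k = x := by
  obtain ⟨i, -, rfl⟩ := (Complex.isPrimitiveRoot_exp p (NeZero.ne p)).eq_pow_of_pow_eq_one hx
  refine ⟨(i : ℤ), ?_⟩
  rw [ZMod.stdAddChar_coe, ← Complex.exp_nat_mul]
  congr 1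
  push_cast
  ring

theorem IsTraceRelation.exists_zmod_cover {p r : ℕ} {C : ℂ} [NeZero p]
    (h : IsTraceRelation (q * p) a b c z) (hs : SplitsUpTo p q C r a b c z) (hC : C ≠ 0) :
    ∃ i j m : ZMod p, a ^ q = ZMod.stdAddChar i ∧ b ^ q = ZMod.stdAddChar j ∧
      c ^ q = ZMod.stdAddChar (-(i + j)) ∧ z ^ q = ZMod.stdAddChar m ∧
      ∀ k, (k = i ∨ k = -i) ∨ (k = j ∨ k = -j) ∨ (k = -(i + j) ∨ k = i + j) ∨
        k = m ∨ k = -m := by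
  obtain ⟨i, hi⟩ := exists_stdAddChar_eq h.coset_a
  obtain ⟨j, hj⟩ := exists_stdAddChar_eq h.rotate.coset_a
  obtain ⟨m, hm⟩ := exists_stdAddChar_eq h.coset_z
  have hc : c ^ q = ZMod.stdAddChar (-(i + j)) := by
    rw [h.coset_c, AddChar.map_neg_eq_inv, AddChar.map_add_eq_mul, hi, hj]
  refine ⟨i, j, m, hi.symm, hj.symm, hc, hm.symm, fun k => ?_⟩
  have hcover := hs.cover (NeZero.ne p) hC (κ := ZMod.stdAddChar k)
    (by rw [← AddChar.map_nsmul_eq_pow, nsmul_eq_mul, CharP.cast_eq_zero, zero_mul,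
      AddChar.map_zero_eq_one])
  simpa only [hc, ← hi, ← hj, ← hm, ← AddChar.map_neg_eq_inv, ZMod.injective_stdAddChar.eq_iff,
    neg_neg] using hcover

theorem cover_zmod_seven : ∀ i j m : ZMod 7,
    (∀ k, (k = i ∨ k = -i) ∨ (k = j ∨ k = -j) ∨ (k = -(i + j) ∨ k = i + j) ∨ k = m ∨ k = -m) →
    m = 0 ∧ i ≠ 0 ∧ (j = 2 * i ∨ -(i + j) = 2 * i) := by
  decide

/-- The exponents `i`, `j`, `m` of the cosets of `a`, `b`, `z` in a solution of the trace equation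
that does not split along the fifth roots of unity, up to rotation of `(a, b, c)`. -/
def IsPatternFive (i j m : ZMod 5) : Prop :=
  i ≠ 0 ∧ ((j = i ∧ m = 0) ∨ (j = -i ∧ (m = 2 * i ∨ m = -(2 * i))))

instance (i j m : ZMod 5) : Decidable (IsPatternFive i j m) := instDecidableAnd

theorem cover_zmod_five : ∀ i j m : ZMod 5,
    (∀ k, (k = i ∨ k = -i) ∨ (k = j ∨ k = -j) ∨ (k = -(i + j) ∨ k = i + j) ∨ k = m ∨ k = -m) →
    IsPatternFive i j m ∨ IsPatternFive j (-(i + j)) m ∨ IsPatternFive (-(i + j)) i m := by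
  decide

/-- The value of `cosetPart q (α ^ k) x` when `x ^ q = α ^ i` and `α` has order `n`. -/
noncomputable def exponentPart (n i k : ℕ) (x : ℂ) : ℂ :=
  (if i % n = k % n then x else 0) + if (i + k) % n = 0 then x⁻¹ else 0

theorem cosetPart_pow {n i : ℕ} {α : ℂ} (hα : IsPrimitiveRoot α n) (hn : n ≠ 0)
    (hx : x ^ q = α ^ i) (k : ℕ) : cosetPart q (α ^ k) x = exponentPart n i k x := by
  have hfin : IsOfFinOrder α := isOfFinOrder_iff_pow_eq_one.2
    ⟨n, Nat.pos_of_ne_zero hn, hα.pow_eq_one⟩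
  have hinv : α ^ i = (α ^ k)⁻¹ ↔ (i + k) % n = 0 := by
    rw [← mul_eq_one_iff_eq_inv₀ (pow_ne_zero k (hα.ne_zero hn)), ← pow_add,
      hα.pow_eq_one_iff_dvd, Nat.dvd_iff_mod_eq_zero]
  simp only [cosetPart, exponentPart, inv_pow_eq_iff, hx, hinv, hfin.pow_inj_mod,
    ← hα.eq_orderOf]

theorem SplitsUpTo.exists_exponentPart_eq {p r : ℕ} {C α : ℂ} (hs : SplitsUpTo p q C r a b c z)
    (hα : IsPrimitiveRoot α p) (hp : p ≠ 0) {i j l m : ℕ} (ha : a ^ q = α ^ i)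
    (hb : b ^ q = α ^ j) (hc : c ^ q = α ^ l) (hz : z ^ q = α ^ m) :
    ∃ g : ℂ, g ^ p = 1 ∧ ∀ k, exponentPart p i k a + exponentPart p j k b +
      exponentPart p l k c - exponentPart p m k z = C * g ^ k := by
  refine ⟨α⁻¹ ^ r, by rw [pow_right_comm, inv_pow, hα.pow_eq_one, inv_one, one_pow], fun k => ?_⟩
  rw [← cosetPart_pow hα hp ha, ← cosetPart_pow hα hp hb, ← cosetPart_pow hα hp hc,
    ← cosetPart_pow hα hp hz, hs _ (by rw [pow_right_comm, hα.pow_eq_one, one_pow]), ← inv_pow,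
    pow_right_comm]

theorem isPrimitiveRoot_of_prime {p : ℕ} [Fact p.Prime] (hx : x ^ p = 1) (hx1 : x ≠ 1) :
    IsPrimitiveRoot x p :=
  orderOf_eq_prime hx hx1 ▸ IsPrimitiveRoot.orderOf x

namespace IsTraceRelation

variable {r : ℕ} {C : ℂ}

theorem isAdmissible_seven (h : IsTraceRelation (q * 7) a b c z) (hs : SplitsUpTo 7 q C r a b c z)
    (ha : a ^ q ≠ 1) (hb : b ^ q = (a ^ q) ^ 2) (hz : z ^ q = 1) : IsAdmissible a b c z := by
  have : Fact (Nat.Prime 7) := ⟨by norm_num⟩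
  have hc : c ^ q = (a ^ q) ^ 4 := by
    rw [h.coset_c, hb, inv_eq_of_mul_eq_one_right]
    linear_combination h.coset_a
  obtain ⟨g, hg7, hsum⟩ := hs.exists_exponentPart_eq (isPrimitiveRoot_of_prime h.coset_a ha)
    (by norm_num) (pow_one _).symm hb hc (hz.trans (pow_zero _).symm)
  have hz_sum : -z⁻¹ + -z = C := by simpa [exponentPart] using hsum 0
  have hag : a = C * g := by simpa [exponentPart] using hsum 1
  have hbg : b = C * g ^ 2 := by simpa [exponentPart] using hsum 2
  have hcg : c = C * g ^ 4 := by simpa [exponentPart] using hsum 4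
  have hag_inv : a⁻¹ = C * g ^ 6 := by simpa [exponentPart] using hsum 6
  have hbg_inv : b⁻¹ = C * g ^ 5 := by simpa [exponentPart] using hsum 5
  have hcg_inv : c⁻¹ = C * g ^ 3 := by simpa [exponentPart] using hsum 3
  have hC2 : C ^ 2 = 1 := by
    linear_combination mul_inv_cancel₀ h.ne_zero_a - a⁻¹ * hag - C * g * hag_inv - C ^ 2 * hg7
  have hC : C = 1 := by
    have hprod := h.prod_eq_one
    rw [hag, hbg, hcg] at hprod
    linear_combination hprod - C ^ 3 * hg7 - C * hC2
  have hg1 : g ≠ 1 := by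
    rintro rfl
    rw [hag, hC, mul_one, one_pow] at ha
    exact ha rfl
  have hgeom : 1 + g + g ^ 2 + g ^ 3 + g ^ 4 + g ^ 5 + g ^ 6 = 0 :=
    mul_left_cancel₀ (sub_ne_zero.2 hg1) (by linear_combination hg7)
  refine Or.inr (Or.inr (Or.inr (Or.inl ⟨by linear_combination -hz_sum - hC, ?_⟩)))
  rw [hag_inv, hbg_inv, hcg_inv, hag, hbg, hcg, hC]
  linear_combination hgeom + (3 + g + g ^ 2 + g ^ 3) * hg7

theorem isAdmissible_five_of_eq (h : IsTraceRelation (q * 5) a b c z)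
    (hs : SplitsUpTo 5 q C r a b c z) (ha : a ^ q ≠ 1) (hb : b ^ q = a ^ q) (hz : z ^ q = 1) :
    IsAdmissible a b c z := by
  have : Fact (Nat.Prime 5) := ⟨by norm_num⟩
  have hc : c ^ q = (a ^ q) ^ 3 := by
    rw [h.coset_c, hb, inv_eq_of_mul_eq_one_right]
    linear_combination h.coset_a
  obtain ⟨g, hg5, hsum⟩ := hs.exists_exponentPart_eq (isPrimitiveRoot_of_prime h.coset_a ha)
    (by norm_num) (pow_one _).symm (hb.trans (pow_one _).symm) hc (hz.trans (pow_zero _).symm)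
  have hz_sum : -z⁻¹ + -z = C := by simpa [exponentPart] using hsum 0
  have hab : a + b = C * g := by simpa [exponentPart] using hsum 1
  have hab_inv : a⁻¹ + b⁻¹ = C * g ^ 4 := by simpa [exponentPart] using hsum 4
  have hcg : c = C * g ^ 3 := by simpa [exponentPart] using hsum 3
  have hcg_inv : c⁻¹ = C * g ^ 2 := by simpa [exponentPart] using hsum 2
  have hC2 : C ^ 2 = 1 := by
    linear_combination mul_inv_cancel₀ h.ne_zero_c - c⁻¹ * hcg - C * g ^ 3 * hcg_inv - C ^ 2 * hg5
  have hC : C = 1 := by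
    have hab_mul : a * b * (a⁻¹ + b⁻¹) = a + b := by
      have := h.ne_zero_a
      have := h.ne_zero_b
      field_simp
      ring
    rw [← h.inv_c, hab, hab_inv, hcg_inv] at hab_mul
    have hg0 : g ≠ 0 := (IsUnit.of_pow_eq_one hg5 (by norm_num)).ne_zero
    refine mul_right_cancel₀ hg0 ?_
    linear_combination -hab_mul + C ^ 2 * g * hg5 + g * hC2
  have hg1 : g ≠ 1 := by
    rintro rfl
    rw [hC, one_pow, mul_one] at hcg
    rw [hcg, one_pow] at hc
    exact (isPrimitiveRoot_of_prime h.coset_a ha).pow_ne_one_of_pos_of_lt (by norm_num)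
      (by norm_num) hc.symm
  have hgeom : 1 + g + g ^ 2 + g ^ 3 + g ^ 4 = 0 :=
    mul_left_cancel₀ (sub_ne_zero.2 hg1) (by linear_combination hg5)
  have hN : (a + b + c) * (a⁻¹ + b⁻¹ + c⁻¹) = 2 + g ^ 2 + g ^ 3 := by
    rw [hab, hab_inv, hcg_inv, hcg, hC]
    linear_combination (2 + g ^ 2) * hg5
  refine Or.inr (Or.inr (Or.inr (Or.inr (Or.inl ⟨by linear_combination -hz_sum - hC, ?_⟩))))
  rw [hN]
  linear_combination hgeom + (2 + g) * hg5

theorem sum_mul_sum_inv_eq_of_add_inv_eq {g : ℂ} (h : IsTraceRelation Q a b c z) (hg5 : g ^ 5 = 1)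
    (hc : c + c⁻¹ = -1) (hab : a + b⁻¹ = -g) (hba : a⁻¹ + b = -g ^ 4) :
    (a + b + c) * (a⁻¹ + b⁻¹ + c⁻¹) = (1 + g + g ^ 4) ^ 2 := by
  have hc_inv := mul_inv_cancel₀ h.ne_zero_c
  have hc_one : 1 + c = -c⁻¹ := by linear_combination hc
  have ha : a = g * c := by
    have hb_inv : b⁻¹ = a * c := inv_eq_of_mul_eq_one_right (by linear_combination h.prod_eq_one)
    rw [hb_inv] at hab
    linear_combination -c * hab + a * c * hc_one - a * hc_inv
  have hb : b = g ^ 4 * c := by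
    have ha_inv : a⁻¹ = b * c := inv_eq_of_mul_eq_one_right (by linear_combination h.prod_eq_one)
    rw [ha_inv] at hba
    linear_combination -c * hba + b * c * hc_one - b * hc_inv
  have hg_inv : g⁻¹ = g ^ 4 := inv_eq_of_mul_eq_one_right (by linear_combination hg5)
  have hg4_inv : (g ^ 4)⁻¹ = g := inv_eq_of_mul_eq_one_right (by linear_combination hg5)
  rw [ha, hb, mul_inv, mul_inv, hg_inv, hg4_inv]
  linear_combination (1 + g + g ^ 4) ^ 2 * hc_inv

theorem isAdmissible_five_of_eq_inv (h : IsTraceRelation (q * 5) a b c z)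
    (hs : SplitsUpTo 5 q C r a b c z) (ha : a ^ q ≠ 1) (hb : b ^ q = (a ^ q)⁻¹)
    (hz : z ^ q = (a ^ q) ^ 2) : IsAdmissible a b c z := by
  have : Fact (Nat.Prime 5) := ⟨by norm_num⟩
  have hb4 : b ^ q = (a ^ q) ^ 4 := by
    rw [hb, inv_eq_of_mul_eq_one_right]
    linear_combination h.coset_a
  obtain ⟨g, hg5, hsum⟩ := hs.exists_exponentPart_eq (isPrimitiveRoot_of_prime h.coset_a ha)
    (by norm_num) (pow_one _).symm hb4 ((h.coset_c_eq_one hb).trans (pow_zero _).symm) hz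
  have hc_sum : c + c⁻¹ = C := by simpa [exponentPart] using hsum 0
  have hab : a + b⁻¹ = C * g := by simpa [exponentPart] using hsum 1
  have hab_inv : a⁻¹ + b = C * g ^ 4 := by simpa [exponentPart] using hsum 4
  have hzg : -z = C * g ^ 2 := by simpa [exponentPart] using hsum 2
  have hzg_inv : -z⁻¹ = C * g ^ 3 := by simpa [exponentPart] using hsum 3
  have ha0 := h.ne_zero_a
  have hb0 := h.ne_zero_b
  have hC2 : C ^ 2 = 1 := by
    linear_combination mul_inv_cancel₀ h.ne_zero_z + z⁻¹ * hzg - C * g ^ 2 * hzg_inv - C ^ 2 * hg5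
  have hC : C = -1 := by
    have hmul : (a + b⁻¹) * (a⁻¹ + b) = 2 + (c + c⁻¹) := by
      rw [← inv_inv c, h.inv_c]
      field_simp
      ring
    rw [hab, hab_inv, hc_sum] at hmul
    linear_combination C ^ 2 * hg5 + hC2 - hmul
  have hg1 : g ≠ 1 := by
    rintro rfl
    rw [hC] at hzg
    exact h.z_ne_one (by linear_combination -hzg)
  have hgeom : 1 + g + g ^ 2 + g ^ 3 + g ^ 4 = 0 :=
    mul_left_cancel₀ (sub_ne_zero.2 hg1) (by linear_combination hg5)
  have ht : z + z⁻¹ = g ^ 2 + g ^ 3 := by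
    rw [hC] at hzg hzg_inv
    linear_combination -hzg - hzg_inv
  rw [hC] at hc_sum hab hab_inv
  have hN := h.sum_mul_sum_inv_eq_of_add_inv_eq hg5 (by linear_combination hc_sum)
    (by linear_combination hab) (by linear_combination hab_inv)
  refine Or.inr (Or.inr (Or.inr (Or.inr (Or.inr ⟨?_, ?_⟩))))
  · rw [ht]
    linear_combination hgeom + (2 + g) * hg5
  · rw [hN, ht]
    linear_combination (1 + g + g ^ 4 - g ^ 2 - g ^ 3) * hgeom

end IsTraceRelation

theorem stdAddChar_ne_one {n : ℕ} [NeZero n] {i : ZMod n} (hi : i ≠ 0) :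
    ZMod.stdAddChar i ≠ 1 := by
  rw [← AddChar.map_zero_eq_one (ZMod.stdAddChar (N := n))]
  exact ZMod.injective_stdAddChar.ne hi

theorem add_inv_eq_zero_iff (hx : x ≠ 0) : x + x⁻¹ = 0 ↔ x ^ 2 = -1 := by
  rw [← mul_left_inj' hx, add_mul, inv_mul_cancel₀ hx, zero_mul, ← pow_two, add_eq_zero_iff_eq_neg]

theorem eq_or_add_inv_eq_of_pow_six (hx : x ^ 6 = 1) :
    x = 1 ∨ x = -1 ∨ x + x⁻¹ = 1 ∨ x + x⁻¹ = -1 := by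
  have hx0 : x ≠ 0 := (IsUnit.of_pow_eq_one hx (by norm_num)).ne_zero
  have hfac : (x - 1) * ((x + 1) * ((x ^ 2 - x + 1) * (x ^ 2 + x + 1))) = 0 := by
    linear_combination hx
  refine (mul_eq_zero.1 hfac).imp sub_eq_zero.1 fun h =>
    (mul_eq_zero.1 h).imp eq_neg_of_add_eq_zero_left fun h =>
    (mul_eq_zero.1 h).imp (fun h => ?_) fun h => ?_
  all_goals
    field_simp
    linear_combination h

theorem exists_int_add_inv_eq (hx : x ^ 6 = 1) :
    ∃ u ∈ ({2, -2, 1, -1} : Finset ℤ), x + x⁻¹ = u := by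
  rcases eq_or_add_inv_eq_of_pow_six hx with rfl | rfl | h | h
  · exact ⟨2, by decide, by norm_num⟩
  · exact ⟨-2, by decide, by norm_num⟩
  · exact ⟨1, by decide, by rw [h, Int.cast_one]⟩
  · exact ⟨-1, by decide, by rw [h, Int.cast_neg, Int.cast_one]⟩

namespace IsTraceRelation

theorem isAdmissible_of_isPatternFive {r : ℕ} {C : ℂ} {i j m : ZMod 5}
    (h : IsTraceRelation (q * 5) a b c z) (hs : SplitsUpTo 5 q C r a b c z)
    (hpat : IsPatternFive i j m) (ha : a ^ q = ZMod.stdAddChar i) (hb : b ^ q = ZMod.stdAddChar j)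
    (hz : z ^ q = ZMod.stdAddChar m) : IsAdmissible a b c z := by
  obtain ⟨hi, ⟨rfl, rfl⟩ | ⟨rfl, hm⟩⟩ := hpat
  all_goals
    have ha1 : a ^ q ≠ 1 := ha ▸ stdAddChar_ne_one hi
  · exact h.isAdmissible_five_of_eq hs ha1 (hb.trans ha.symm)
      (hz.trans (AddChar.map_zero_eq_one _))
  · rw [AddChar.map_neg_eq_inv, ← ha] at hb
    have hsq : ZMod.stdAddChar (2 * i) = (a ^ q) ^ 2 := by
      rw [ha, two_mul, AddChar.map_add_eq_mul, pow_two]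
    rcases hm with rfl | rfl
    · exact h.isAdmissible_five_of_eq_inv hs ha1 hb (hz.trans hsq)
    · refine (h.inv_z.isAdmissible_five_of_eq_inv hs.inv_z ha1 hb ?_).inv_z
      rw [inv_pow, hz, AddChar.map_neg_eq_inv, inv_inv, hsq]

theorem isAdmissible_of_splitsUpTo {p r : ℕ} {C : ℂ} (hp : p.Prime) (hp5 : 5 ≤ p)
    (h : IsTraceRelation (q * p) a b c z) (hs : SplitsUpTo p q C r a b c z) (hC : C ≠ 0) :
    IsAdmissible a b c z := by
  have : NeZero p := ⟨hp.ne_zero⟩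
  obtain ⟨i, j, m, ha, hb, hc, hz, hcover⟩ := h.exists_zmod_cover hs hC
  obtain rfl | rfl : p = 5 ∨ p = 7 := by
    have hp8 := hs.le_eight hp.ne_zero hC
    interval_cases p <;> revert hp <;> decide
  · rcases cover_zmod_five i j m hcover with hpat | hpat | hpat
    · exact h.isAdmissible_of_isPatternFive hs hpat ha hb hz
    · exact (h.rotate.isAdmissible_of_isPatternFive hs.rotate hpat hb hc hz).rotate
    · exact (h.rotate.rotate.isAdmissible_of_isPatternFive hs.rotate.rotate hpat hc ha hz
        ).rotate.rotate
  · obtain ⟨rfl, hi, hij⟩ := cover_zmod_seven i j m hcover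
    have ha1 : a ^ q ≠ 1 := ha ▸ stdAddChar_ne_one hi
    have hsq : ZMod.stdAddChar (2 * i) = (a ^ q) ^ 2 := by
      rw [ha, two_mul, AddChar.map_add_eq_mul, pow_two]
    rw [AddChar.map_zero_eq_one] at hz
    rcases hij with hij | hij
    · exact h.isAdmissible_seven hs ha1 (by rw [hb, hij, hsq]) hz
    · exact (h.swap.isAdmissible_seven hs.swap ha1 (by rw [hc, hij, hsq]) hz).swap

theorem isAdmissible_or_descend_prime {p : ℕ} (hp : p.Prime) (hp2 : p ≠ 2) (h3 : 3 ∣ q)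
    (h : IsTraceRelation (q * p) a b c z) : IsAdmissible a b c z ∨ IsTraceRelation q a b c z := by
  have hodd := hp.odd_of_ne_two hp2
  by_cases hpq : p ∣ q
  · exact h.isAdmissible_or_descend hodd (h.splitsAlong (k := 1) (by rwa [pow_one]))
  obtain ⟨C, r, hs⟩ := h.exists_cosetPart_eq hp ((hp.coprime_iff_not_dvd).2 hpq)
  rcases eq_or_ne C 0 with rfl | hC
  · exact h.isAdmissible_or_descend hodd (SplitsUpTo.splitsAlong hs)
  · have hp3 : p ≠ 3 := by rintro rfl; exact hpq h3
    exact .inl (h.isAdmissible_of_splitsUpTo hp (hp.five_le_of_ne_two_of_ne_three hp2 hp3) hs hC)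

/- As `c ^ q = 1`, the number `q` is divisible by `4`, so the equation splits further along the
fourth roots of unity. -/
theorem isAdmissible_of_add_inv_eq_zero (h : IsTraceRelation (q * 2) a b c z) (hq : 2 ∣ q)
    (ha : a ^ q = -1) (hb : b ^ q = -1) (hc : c ^ q = 1) (hz : z ^ q = -1) (hc0 : c + c⁻¹ = 0) :
    IsAdmissible a b c z := by
  obtain ⟨r, rfl⟩ := hq
  have hr : Even r := by
    rw [pow_mul, (add_inv_eq_zero_iff h.ne_zero_c).1 hc0] at hc
    exact (neg_one_pow_eq_one_iff_even (by norm_num)).1 hc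
  rw [show 2 * r * 2 = r * 4 by ring] at h
  have hs : SplitsAlong 4 r a b c z :=
    h.splitsAlong (k := 2) (by simpa using pow_dvd_pow_of_dvd hr.two_dvd 2)
  rw [mul_comm, pow_mul] at ha hb hc hz
  have hne : z ^ r ≠ (z ^ r)⁻¹ := by
    rw [Ne, ← mul_eq_one_iff_eq_inv₀ (pow_ne_zero r h.ne_zero_z), ← pow_two, hz]
    norm_num
  have hinv : (z ^ r)⁻¹ = -z ^ r := inv_eq_of_mul_eq_one_right (by linear_combination -hz)
  have hcz : cosetPart r (z ^ r) c = 0 := by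
    refine cosetPart_of_ne (fun he => ?_) fun he => ?_ <;> norm_num [he, hz, inv_pow] at hc
  have hcases {x : ℂ} (hx : (x ^ r) ^ 2 = -1) : x ^ r = z ^ r ∨ x ^ r = (z ^ r)⁻¹ := by
    rw [hinv]
    exact sq_eq_sq_iff_eq_or_eq_neg.1 (hx.trans hz.symm)
  have hsum := hs (z ^ r) h.coset_z
  rw [hcz, add_zero, cosetPart_of_eq rfl hne] at hsum
  rcases hcases ha with ha | ha <;> rcases hcases hb with hb | hb
  · rw [cosetPart_of_eq ha hne, cosetPart_of_eq hb hne] at hsum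
    exact h.isAdmissible_of_add_eq hc0 hsum
  · rw [cosetPart_of_eq ha hne, cosetPart_of_eq_inv hb hne] at hsum
    exact absurd hsum (h.add_inv_ne hc0)
  · rw [cosetPart_of_eq_inv ha hne, cosetPart_of_eq hb hne, add_comm] at hsum
    exact absurd hsum (h.rotate.swap.add_inv_ne hc0)
  · rw [cosetPart_of_eq_inv ha hne, cosetPart_of_eq_inv hb hne] at hsum
    exact (h.inv_z.isAdmissible_of_add_eq hc0 (by linear_combination h.sum_eq - hc0 - hsum)).inv_z

theorem isAdmissible_of_pow_eq_neg_one (h : IsTraceRelation (q * 2) a b c z) (hq : 2 ∣ q)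
    (ha : a ^ q = -1) (hb : b ^ q = -1) : IsAdmissible a b c z := by
  have hs : SplitsAlong 2 q a b c z := h.splitsAlong (k := 1) (by rwa [pow_one])
  have hc : c ^ q = 1 := h.coset_c_eq_one (by rw [ha, hb, inv_neg, inv_one])
  have hneg : (-1 : ℂ) = (-1)⁻¹ := by norm_num
  have hsum := hs (-1) (by norm_num)
  rw [cosetPart_of_eq_self_inv ha hneg, cosetPart_of_eq_self_inv hb hneg,
    cosetPart_of_pow_eq_one hc (by norm_num), add_zero] at hsum
  rcases sq_eq_one_iff.1 h.coset_z with hz | hz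
  · rw [cosetPart_of_pow_eq_one hz (by norm_num)] at hsum
    exact h.isAdmissible_of_add_eq_zero hsum
  · rw [cosetPart_of_eq_self_inv hz hneg] at hsum
    exact h.isAdmissible_of_add_inv_eq_zero hq ha hb hc hz (by linear_combination h.sum_eq - hsum)

theorem isAdmissible_or_descend_two (h : IsTraceRelation (q * 2) a b c z) (hq : 2 ∣ q) :
    IsAdmissible a b c z ∨
      a ^ q = 1 ∧ b ^ q = 1 ∧ c ^ q = 1 ∧ (z ^ q = 1 ∨ z + z⁻¹ = 0) := by
  have hs : SplitsAlong 2 q a b c z := h.splitsAlong (k := 1) (by rwa [pow_one])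
  have hprod : a ^ q * b ^ q * c ^ q = 1 := by rw [← mul_pow, ← mul_pow, h.prod_eq_one, one_pow]
  rcases sq_eq_one_iff.1 h.coset_a with ha | ha <;>
    rcases sq_eq_one_iff.1 h.rotate.coset_a with hb | hb
  · have hc : c ^ q = 1 := by simpa [ha, hb] using hprod
    refine .inr ⟨ha, hb, hc, (sq_eq_one_iff.1 h.coset_z).imp_right fun hz => ?_⟩
    have hsum := hs (-1) (by norm_num)
    rw [cosetPart_of_eq_self_inv hz (by norm_num), cosetPart_of_pow_eq_one ha (by norm_num),
      cosetPart_of_pow_eq_one hb (by norm_num), cosetPart_of_pow_eq_one hc (by norm_num)] at hsum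
    linear_combination -hsum
  · have hc : c ^ q = -1 := by rw [ha, hb] at hprod; linear_combination -hprod
    exact .inl (h.rotate.isAdmissible_of_pow_eq_neg_one hq hb hc).rotate
  · have hc : c ^ q = -1 := by rw [ha, hb] at hprod; linear_combination -hprod
    exact .inl (h.rotate.rotate.isAdmissible_of_pow_eq_neg_one hq hc ha).rotate.rotate
  · exact .inl (h.isAdmissible_of_pow_eq_neg_one hq ha hb)

theorem trace_identity (h : IsTraceRelation Q a b c z) :
    (a + a⁻¹) ^ 2 + (b + b⁻¹) ^ 2 + (c + c⁻¹) ^ 2 - (a + a⁻¹) * (b + b⁻¹) * (c + c⁻¹) = 4 := by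
  have ha := h.ne_zero_a
  have hb := h.ne_zero_b
  rw [← inv_inv c, h.inv_c]
  field_simp
  ring

theorem sum_mul_sum_inv (h : IsTraceRelation Q a b c z) :
    (a + b + c) * (a⁻¹ + b⁻¹ + c⁻¹) =
      3 + ((a + a⁻¹) * (b + b⁻¹) + (b + b⁻¹) * (c + c⁻¹) + (c + c⁻¹) * (a + a⁻¹)) - (z + z⁻¹) := by
  have ha := h.ne_zero_a
  have hb := h.ne_zero_b
  rw [← h.sum_eq, ← inv_inv c, h.inv_c]
  field_simp
  ring

theorem cases_of_sextic_traces : ∀ u ∈ ({2, -2, 1, -1} : Finset ℤ),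
    ∀ v ∈ ({2, -2, 1, -1} : Finset ℤ), ∀ w ∈ ({2, -2, 1, -1} : Finset ℤ),
    u + v + w ∈ ({1, -1, 0} : Finset ℤ) → u ^ 2 + v ^ 2 + w ^ 2 - u * v * w = 4 →
    3 + (u * v + v * w + w * u) - (u + v + w) = 1 ∨
      u + v + w = 0 ∧ 3 + (u * v + v * w + w * u) - (u + v + w) = 0 := by
  decide

theorem isAdmissible_of_pow_six (h : IsTraceRelation Q a b c z) (ha : a ^ 6 = 1) (hb : b ^ 6 = 1)
    (hc : c ^ 6 = 1) (hz : z ^ 6 = 1 ∨ z + z⁻¹ = 0) : IsAdmissible a b c z := by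
  obtain ⟨u, hu, hau⟩ := exists_int_add_inv_eq ha
  obtain ⟨v, hv, hbv⟩ := exists_int_add_inv_eq hb
  obtain ⟨w, hw, hcw⟩ := exists_int_add_inv_eq hc
  have hsum : z + z⁻¹ = (u + v + w : ℤ) := by
    rw [← h.sum_eq, hau, hbv, hcw]; push_cast; rfl
  have hid := h.trace_identity
  rw [IsAdmissible, IsTracePair, h.sum_mul_sum_inv, hsum]
  rw [hau, hbv, hcw] at hid ⊢
  norm_cast at hid ⊢
  refine (cases_of_sextic_traces u hu v hv w hw ?_ hid).imp_right .inl
  have ht : z + z⁻¹ = (1 : ℤ) ∨ z + z⁻¹ = (-1 : ℤ) ∨ z + z⁻¹ = (0 : ℤ) := by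
    rcases hz with hz | hz
    · rcases eq_or_add_inv_eq_of_pow_six hz with hz | hz | hz | hz
      · exact absurd hz h.z_ne_one
      · exact absurd hz h.z_ne_neg_one
      · exact .inl (by rw [hz, Int.cast_one])
      · exact .inr (.inl (by rw [hz, Int.cast_neg, Int.cast_one]))
    · exact .inr (.inr (by rw [hz, Int.cast_zero]))
  simpa only [hsum, Int.cast_inj, Finset.mem_insert, Finset.mem_singleton] using ht

theorem mul_left {k : ℕ} (hk : k ≠ 0) (h : IsTraceRelation Q a b c z) :
    IsTraceRelation (k * Q) a b c z :=
  ⟨mul_ne_zero hk h.ne_zero, by rw [pow_mul', h.pow_a, one_pow], by rw [pow_mul', h.pow_b, one_pow],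
    by rw [pow_mul', h.pow_c, one_pow], by rw [pow_mul', h.pow_z, one_pow], h.prod_eq_one,
    h.sum_eq, h.z_ne_one, h.z_ne_neg_one⟩

theorem isAdmissible_of_twelve_mul {k : ℕ} (h : IsTraceRelation (12 * k) a b c z) :
    IsAdmissible a b c z := by
  induction k using induction_on_primes with
  | zero => exact absurd rfl h.ne_zero
  | one =>
    rcases isAdmissible_or_descend_two (q := 6) h (by norm_num) with hadm | ⟨ha, hb, hc, hz⟩
    · exact hadm
    · exact h.isAdmissible_of_pow_six ha hb hc hz
  | prime_mul p k hp ih =>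
    rw [mul_left_comm, mul_comm] at h
    rcases eq_or_ne p 2 with rfl | hp2
    · rcases h.isAdmissible_or_descend_two (dvd_mul_of_dvd_left (by norm_num) k) with
        hadm | ⟨ha, hb, hc, hz⟩
      · exact hadm
      · refine ih ⟨left_ne_zero_of_mul h.ne_zero, ha, hb, hc, hz.elim id fun hz => ?_,
          h.prod_eq_one, h.sum_eq, h.z_ne_one, h.z_ne_neg_one⟩
        rw [show 12 * k = 2 * (2 * (3 * k)) by ring, pow_mul,
          (add_inv_eq_zero_iff h.ne_zero_z).1 hz, pow_mul, neg_one_sq, one_pow]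
    · exact (h.isAdmissible_or_descend_prime hp hp2 (dvd_mul_of_dvd_left (by norm_num) k)).elim
        id ih

theorem isAdmissible (h : IsTraceRelation Q a b c z) : IsAdmissible a b c z :=
  isAdmissible_of_twelve_mul (h.mul_left (by norm_num))

end IsTraceRelation

end

/-! ### Braid relations between two reflections -/

/-- The alternating product `a b a ⋯` with `l` factors in a monoid; `altProd` asks for a group, but
reflections are compared here as matrices. -/
def altMul {M : Type*} [Monoid M] (a b : M) : ℕ → M
  | 0 => 1
  | l + 1 => a * altMul b a l

theorem map_altProd {G M : Type*} [Group G] [Monoid M] (f : G →* M) (a b : G) (l : ℕ) :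
    f (altProd a b l) = altMul (f a) (f b) l := by
  induction l generalizing a b with
  | zero => exact map_one f
  | succ l ih => rw [altProd, altMul, map_mul, ih]

theorem altMul_add_two {M : Type*} [Monoid M] (a b : M) (l : ℕ) :
    altMul a b (l + 2) = a * b * altMul a b l :=
  (mul_assoc a b (altMul a b l)).symm

theorem altMul_smul {K A : Type*} [CommSemiring K] [Semiring A] [Algebra K A] (s : K) (a b : A)
    (l : ℕ) : altMul (s • a) (s • b) l = s ^ l • altMul a b l := by
  induction l generalizing a b with
  | zero => simp only [altMul, pow_zero, one_smul]
  | succ l ih => rw [altMul, altMul, ih, smul_mul_smul_comm, pow_succ']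

theorem mul_altMul_eq_self {M : Type*} [Monoid M] {e a b : M} (ha : e * a = e) (hb : e * b = e)
    (l : ℕ) : e * altMul a b l = e := by
  induction l generalizing a b with
  | zero => exact mul_one e
  | succ l ih => rw [altMul, ← mul_assoc, ha, ih hb ha]

/-- The difference of the two alternating products of `1 + P` and `1 + Q` with `l` factors. -/
def braidDiff {A : Type*} [Ring A] (P Q : A) (l : ℕ) : A :=
  altMul (1 + P) (1 + Q) l - altMul (1 + Q) (1 + P) l

/-- The relations between `P` and `Q` when `1 + P` and `1 + Q` are reflections with multiplier `ω`;
`r` measures the angle between their mirrors. -/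
structure IsReflectionPair {K A : Type*} [CommRing K] [Ring A] [Algebra K A] (ω r : K) (P Q : A) :
    Prop where
  left_mul_self : P * P = (ω - 1) • P
  right_mul_self : Q * Q = (ω - 1) • Q
  left_mul_right_mul_left : P * Q * P = (-ω * r ^ 2) • P
  right_mul_left_mul_right : Q * P * Q = (-ω * r ^ 2) • Q

namespace IsReflectionPair

section

variable {K A : Type*} [CommRing K] [Ring A] [Algebra K A] {ω r : K} {P Q : A}

theorem symm (h : IsReflectionPair ω r P Q) : IsReflectionPair ω r Q P :=
  ⟨h.right_mul_self, h.left_mul_self, h.right_mul_left_mul_right, h.left_mul_right_mul_left⟩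

/-- The quadratic polynomial `x² - ω (2 - r²) x + ω²` evaluated at `x = (1 + P) (1 + Q)`; it
annihilates the span of the polar vectors of the two reflections. -/
def mulQuadratic (ω r : K) (P Q : A) : A :=
  (1 + P) * (1 + Q) * ((1 + P) * (1 + Q)) - (ω * (2 - r ^ 2)) • ((1 + P) * (1 + Q)) + ω ^ 2 • 1

theorem mul_mul_left (h : IsReflectionPair ω r P Q) (W : A) :
    W * P * P = (ω - 1) • (W * P) := by
  rw [mul_assoc, h.left_mul_self, mul_smul_comm]

theorem mulQuadratic_comm (h : IsReflectionPair ω r P Q) :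
    mulQuadratic ω r P Q = mulQuadratic ω r Q P := by
  simp only [mulQuadratic, mul_add, add_mul, one_mul, mul_one, smul_add, ← mul_assoc,
    h.left_mul_self, h.right_mul_self, h.mul_mul_left, h.symm.mul_mul_left, smul_mul_assoc,
    h.left_mul_right_mul_left, h.right_mul_left_mul_right]
  module

theorem mulQuadratic_mul_left (h : IsReflectionPair ω r P Q) : mulQuadratic ω r P Q * P = 0 := by
  simp only [mulQuadratic, mul_add, add_mul, sub_mul, one_mul, mul_one, smul_mul_assoc, smul_add,
    ← mul_assoc, h.left_mul_self, h.right_mul_self, h.mul_mul_left, h.symm.mul_mul_left,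
    h.left_mul_right_mul_left, h.right_mul_left_mul_right]
  module

theorem mulQuadratic_mul_altMul (h : IsReflectionPair ω r P Q) (l : ℕ) :
    mulQuadratic ω r P Q * altMul (1 + P) (1 + Q) l = mulQuadratic ω r P Q := by
  refine mul_altMul_eq_self ?_ ?_ l
  · rw [mul_one_add, h.mulQuadratic_mul_left, add_zero]
  · rw [mul_one_add, h.mulQuadratic_comm, h.symm.mulQuadratic_mul_left, add_zero]

theorem mulQuadratic_mul_altMul_eq (l : ℕ) :
    mulQuadratic ω r P Q * altMul (1 + P) (1 + Q) l =
      altMul (1 + P) (1 + Q) (l + 4) - (ω * (2 - r ^ 2)) • altMul (1 + P) (1 + Q) (l + 2) +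
        ω ^ 2 • altMul (1 + P) (1 + Q) l := by
  rw [altMul_add_two _ _ (l + 2), altMul_add_two _ _ l, mulQuadratic, add_mul, sub_mul,
    smul_mul_assoc, smul_one_mul, mul_assoc ((1 + P) * (1 + Q))]

theorem braidDiff_add_four (h : IsReflectionPair ω r P Q) (l : ℕ) :
    braidDiff P Q (l + 4) =
      (ω * (2 - r ^ 2)) • braidDiff P Q (l + 2) - ω ^ 2 • braidDiff P Q l := by
  have hPQ := h.mulQuadratic_mul_altMul l
  have hQP := h.symm.mulQuadratic_mul_altMul l
  rw [mulQuadratic_mul_altMul_eq] at hPQ hQP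
  rw [braidDiff, braidDiff, braidDiff, ← sub_eq_zero, ← sub_eq_zero.2 h.mulQuadratic_comm,
    ← hPQ, ← hQP]
  module

theorem chebyshev_eval_add_two (r : K) (n : ℤ) :
    (Polynomial.Chebyshev.S K (n + 2)).eval r =
      r * (Polynomial.Chebyshev.S K (n + 1)).eval r - (Polynomial.Chebyshev.S K n).eval r := by
  rw [Polynomial.Chebyshev.S_add_two, Polynomial.eval_sub, Polynomial.eval_mul, Polynomial.eval_X]

theorem chebyshev_eval_add_four (r : K) (n : ℤ) :
    (Polynomial.Chebyshev.S K (n + 4)).eval r =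
      (r ^ 2 - 2) * (Polynomial.Chebyshev.S K (n + 2)).eval r -
        (Polynomial.Chebyshev.S K n).eval r := by
  have h₃ := chebyshev_eval_add_two r (n + 1)
  have h₄ := chebyshev_eval_add_two r (n + 2)
  rw [show n + 1 + 2 = n + 3 by ring, show n + 1 + 1 = n + 2 by ring] at h₃
  rw [show n + 2 + 2 = n + 4 by ring, show n + 2 + 1 = n + 3 by ring] at h₄
  linear_combination h₄ + r * h₃ + chebyshev_eval_add_two r n

theorem braidDiff_odd (h : IsReflectionPair ω r P Q) (j : ℕ) :
    braidDiff P Q (2 * j + 1) =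
      ((-ω) ^ j * (Polynomial.Chebyshev.S K (2 * j)).eval r) • braidDiff P Q 1 := by
  induction j using Nat.twoStepInduction with
  | zero => simp
  | one =>
    simp only [braidDiff, altMul, mul_add, add_mul, one_mul, mul_one, ← mul_assoc,
      h.left_mul_self, h.right_mul_self, h.left_mul_right_mul_left, h.right_mul_left_mul_right,
      Nat.cast_one, Polynomial.Chebyshev.S_two, Polynomial.eval_sub, Polynomial.eval_pow,
      Polynomial.eval_X, Polynomial.eval_one, pow_one]
    module
  | more j ih₀ ih₁ =>
    rw [show 2 * (j + 2) + 1 = 2 * j + 1 + 4 by ring, h.braidDiff_add_four,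
      show 2 * j + 1 + 2 = 2 * (j + 1) + 1 by ring, ih₀, ih₁]
    push_cast
    rw [show (2 * (j + 2) : ℤ) = 2 * j + 4 by ring, chebyshev_eval_add_four,
      show (2 * j + 2 : ℤ) = 2 * (j + 1) by ring]
    module

theorem smul_braidDiff_even (h : IsReflectionPair ω r P Q) (j : ℕ) :
    r • braidDiff P Q (2 * j + 2) =
      ((-ω) ^ j * (Polynomial.Chebyshev.S K (2 * j + 1)).eval r) • braidDiff P Q 2 := by
  induction j using Nat.twoStepInduction with
  | zero => simp
  | one =>
    have h₀ : braidDiff P Q 0 = 0 := sub_self 1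
    rw [show 2 * 1 + 2 = 0 + 4 by rfl, h.braidDiff_add_four, h₀, Nat.cast_one,
      show (2 * 1 + 1 : ℤ) = 1 + 2 by rfl, chebyshev_eval_add_two, one_add_one_eq_two]
    simp only [Polynomial.Chebyshev.S_one, Polynomial.Chebyshev.S_two, Polynomial.eval_sub,
      Polynomial.eval_pow, Polynomial.eval_X, Polynomial.eval_one, pow_one]
    module
  | more j ih₀ ih₁ =>
    rw [show 2 * (j + 2) + 2 = 2 * j + 2 + 4 by ring, h.braidDiff_add_four, smul_sub, smul_comm,
      smul_comm r (ω ^ 2), show 2 * j + 2 + 2 = 2 * (j + 1) + 2 by ring, ih₀, ih₁]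
    push_cast
    rw [show (2 * (j + 2) + 1 : ℤ) = 2 * j + 1 + 4 by ring, chebyshev_eval_add_four,
      show (2 * j + 1 + 2 : ℤ) = 2 * (j + 1) + 1 by ring]
    module

end

theorem braidDiff_eq_zero_iff {K A : Type*} [Field K] [Ring A] [Algebra K A] {ω r : K} {P Q : A}
    (h : IsReflectionPair ω r P Q) (hω : ω ≠ 0) (hr : r ≠ 0) (h₁ : braidDiff P Q 1 ≠ 0)
    (h₂ : braidDiff P Q 2 ≠ 0) (l : ℕ) :
    braidDiff P Q (l + 1) = 0 ↔ (Polynomial.Chebyshev.S K l).eval r = 0 := by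
  have hω' (j : ℕ) : (-ω) ^ j ≠ 0 := pow_ne_zero j (neg_ne_zero.2 hω)
  rcases Nat.even_or_odd' l with ⟨j, rfl | rfl⟩
  · rw [h.braidDiff_odd, smul_eq_zero_iff_left h₁, mul_eq_zero_iff_left (hω' j)]
    norm_cast
  · rw [← smul_eq_zero_iff_right hr, h.smul_braidDiff_even, smul_eq_zero_iff_left h₂,
      mul_eq_zero_iff_left (hω' j)]
    norm_cast

end IsReflectionPair

theorem chebyshev_eval_eq_zero_iff (l : ℕ) (r : ℝ) :
    (Polynomial.Chebyshev.S ℝ l).eval r = 0 ↔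
      ∃ k, 0 < k ∧ k < l + 1 ∧ r = 2 * Real.cos (k * Real.pi / (l + 1 : ℕ)) := by
  have hU : (Polynomial.Chebyshev.S ℝ l).eval r = (Polynomial.Chebyshev.U ℝ l).eval (r / 2) := by
    rw [← Polynomial.Chebyshev.S_comp_two_mul_X, Polynomial.eval_comp, Polynomial.eval_mul,
      Polynomial.eval_ofNat, Polynomial.eval_X, mul_div_cancel₀ r two_ne_zero]
  have hU0 : Polynomial.Chebyshev.U ℝ l ≠ 0 := fun h => by
    have := congrArg (Polynomial.eval 1) h
    rw [Polynomial.Chebyshev.U_eval_one, Polynomial.eval_zero] at this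
    norm_cast at this
  rw [hU, ← Polynomial.IsRoot.def, ← Polynomial.mem_roots hU0, Polynomial.Chebyshev.roots_U_real]
  simp only [Finset.mem_val, Finset.mem_image, Finset.mem_range, eq_div_iff (two_ne_zero' ℝ),
    mul_comm _ (2 : ℝ), eq_comm (b := r)]
  constructor
  · rintro ⟨k, hk, rfl⟩
    exact ⟨k + 1, k.succ_pos, Nat.succ_lt_succ hk, by push_cast; rfl⟩
  · rintro ⟨_ | k, hk0, hk, rfl⟩
    · exact absurd hk0 (lt_irrefl 0)
    · exact ⟨k, Nat.lt_of_succ_lt_succ hk, by push_cast; rfl⟩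

theorem two_mul_lt_of_cos_pos {k m : ℕ} (hkm : k < m) (h : 0 < Real.cos (k * Real.pi / m)) :
    2 * k < m := by
  contrapose! h
  have hm : (0 : ℝ) < m := by exact_mod_cast hkm.pos
  have hle : (m : ℝ) ≤ 2 * k := by exact_mod_cast h
  have hlt : (k : ℝ) < m := by exact_mod_cast hkm
  refine Real.cos_nonpos_of_pi_div_two_le_of_le ?_ ?_
  · rw [le_div_iff₀ hm]
    nlinarith [Real.pi_pos]
  · rw [div_le_iff₀ hm]
    nlinarith [Real.pi_pos]

theorem IsReflectionPair.exists_eq_two_mul_cos {A : Type*} [Ring A] [Algebra ℂ A] {P Q : A}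
    {ω : ℂ} {r : ℝ} {m : ℕ} (h : IsReflectionPair ω (r : ℂ) P Q) (hω : ω ≠ 0) (hr : 0 < r)
    (hm : 3 ≤ m) (hmin : ∀ l, 1 ≤ l → l < m → braidDiff P Q l ≠ 0) (hbr : braidDiff P Q m = 0) :
    ∃ k : ℕ, 0 < k ∧ 2 * k < m ∧ k.Coprime m ∧ r = 2 * Real.cos (k * Real.pi / m) := by
  have hiff (l : ℕ) (hl : 1 ≤ l) : braidDiff P Q l = 0 ↔
      ∃ k, 0 < k ∧ k < l ∧ r = 2 * Real.cos (k * Real.pi / l) := by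
    obtain ⟨l, rfl⟩ := Nat.exists_eq_add_of_le' hl
    rw [h.braidDiff_eq_zero_iff hω (Complex.ofReal_ne_zero.2 hr.ne')
      (hmin 1 le_rfl (by omega)) (hmin 2 (by omega) (by omega)),
      ← Polynomial.Chebyshev.complex_ofReal_eval_S, Complex.ofReal_eq_zero,
      chebyshev_eval_eq_zero_iff]
  obtain ⟨k, hk0, hkm, hrk⟩ := (hiff m (by omega)).1 hbr
  refine ⟨k, hk0, two_mul_lt_of_cos_pos hkm (by linarith), ?_, hrk⟩
  obtain ⟨k', m', -, hk', hm'⟩ := Nat.exists_coprime k m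
  have hm0 : 0 < m' := Nat.pos_of_mul_pos_right (b := k.gcd m) (by omega)
  by_contra hg
  have hg2 : 1 < k.gcd m := lt_of_le_of_ne (Nat.gcd_pos_of_pos_left m hk0) (Ne.symm hg)
  have hlt : m' < m := by nlinarith
  refine hmin m' hm0 hlt ((hiff m' hm0).2 ⟨k', by nlinarith, by nlinarith, ?_⟩)
  rw [hrk]
  congr 2
  have hkR : (k : ℝ) = k' * k.gcd m := by exact_mod_cast hk'
  have hmR : (m : ℝ) = m' * k.gcd m := by exact_mod_cast hm'
  have hgR : (k.gcd m : ℝ) ≠ 0 := by positivity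
  rw [hkR, hmR, mul_right_comm, mul_div_mul_right _ _ hgR]

/-! ### The Hermitian form and normalised polar vectors -/

theorem herm21_smul_left (s : ℂ) (z w : Fin 3 → ℂ) : herm21 (s • z) w = s * herm21 z w := by
  simp only [herm21, Pi.smul_apply, smul_eq_mul]
  ring

theorem herm21_conj (z w : Fin 3 → ℂ) : conj (herm21 z w) = herm21 w z := by
  simp only [herm21, map_sub, map_add, map_mul, Complex.conj_conj]
  ring

theorem herm21_smul_right (s : ℂ) (z w : Fin 3 → ℂ) :
    herm21 z (s • w) = conj s * herm21 z w := by
  rw [← herm21_conj, herm21_smul_left, map_mul, herm21_conj]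

theorem herm21_add_right (z w w' : Fin 3 → ℂ) :
    herm21 z (w + w') = herm21 z w + herm21 z w' := by
  simp only [herm21, Pi.add_apply, map_add]
  ring

theorem herm21_zero_left (w : Fin 3 → ℂ) : herm21 0 w = 0 := by
  rw [← zero_smul ℂ (0 : Fin 3 → ℂ), herm21_smul_left, zero_mul]

theorem herm21_smul_smul_self (s : ℂ) (v : Fin 3 → ℂ) :
    herm21 (s • v) (s • v) = (‖s‖ ^ 2 : ℝ) * herm21 v v := by
  rw [herm21_smul_left, herm21_smul_right, ← mul_assoc, Complex.mul_conj,
    Complex.normSq_eq_norm_sq]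

theorem herm21_mul_herm21_comm (v w : Fin 3 → ℂ) :
    herm21 v w * herm21 w v = (‖herm21 v w‖ : ℂ) ^ 2 := by
  rw [← herm21_conj v w, Complex.mul_conj, Complex.normSq_eq_norm_sq, Complex.ofReal_pow]

theorem norm_herm21_comm (v w : Fin 3 → ℂ) : ‖herm21 v w‖ = ‖herm21 w v‖ := by
  rw [← herm21_conj, RCLike.norm_conj]

theorem exists_norm_eq_one_herm21_smul_eq (v w : Fin 3 → ℂ) {d : ℂ} (hd : ‖d‖ = 1) :
    ∃ e : ℂ, ‖e‖ = 1 ∧ herm21 (e • v) w = d * ‖herm21 v w‖ := by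
  rcases eq_or_ne (herm21 v w) 0 with h | h
  · exact ⟨1, norm_one, by rw [herm21_smul_left, h, mul_zero, norm_zero, Complex.ofReal_zero,
      mul_zero]⟩
  · refine ⟨d * ‖herm21 v w‖ / herm21 v w, ?_, ?_⟩
    · rw [norm_div, norm_mul, hd, one_mul, Complex.norm_real, norm_norm,
        div_self (norm_ne_zero_iff.2 h)]
    · rw [herm21_smul_left, div_mul_cancel₀ _ h]

/-- The row vector of the linear form `z ↦ ⟨z, v⟩`. -/
noncomputable def dualVec (v : Fin 3 → ℂ) : Fin 3 → ℂ := ![conj (v 0), conj (v 1), -conj (v 2)]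

theorem dotProduct_dualVec (z v : Fin 3 → ℂ) : z ⬝ᵥ dualVec v = herm21 z v := by
  simp only [dotProduct, Fin.sum_univ_three, dualVec, herm21, Matrix.cons_val]
  ring

/-- `u^{1/2} = e^{πi/(3p)}`, a cube root of `e^{πi/p}`; every constant attached to a complex
reflection of order `p` is expressed through it. -/
noncomputable def sqrtU (p : ℕ) : ℂ := Complex.exp (Real.pi * Complex.I / (3 * p))

/-- `α = √(2 - 2 cos (2π/p))`, the diagonal entry of `hermitianH`. -/
noncomputable def alphaH (p : ℕ) : ℝ := Real.sqrt (2 - 2 * Real.cos (2 * Real.pi / p))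

/-- `-i ū^{1/2}`, the factor between the parameters and the off-diagonal entries of
`hermitianH`. -/
noncomputable def phaseH (p : ℕ) : ℂ := -Complex.I * (sqrtU p)⁻¹

/-- The rank one matrix `P` for which the reflection with polar vector `v` is `u⁻¹ (1 + P)`, when
`v` is normalised by `⟨v, v⟩ = α`. -/
noncomputable def reflPart (p : ℕ) (v : Fin 3 → ℂ) : Matrix (Fin 3) (Fin 3) ℂ :=
  (Complex.I * sqrtU p ^ 3) • Matrix.vecMulVec v (dualVec v)

section

variable {p : ℕ}

theorem sqrtU_ne_zero : sqrtU p ≠ 0 := Complex.exp_ne_zero _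

theorem inv_sqrtU_sq_ne_zero : (sqrtU p)⁻¹ ^ 2 ≠ 0 := pow_ne_zero 2 (inv_ne_zero sqrtU_ne_zero)

theorem norm_sqrtU : ‖sqrtU p‖ = 1 := by
  rw [sqrtU, show (Real.pi * Complex.I / (3 * p) : ℂ) = (Real.pi / (3 * p) : ℝ) * Complex.I by
    push_cast; ring, Complex.norm_exp_ofReal_mul_I]

theorem conj_sqrtU : conj (sqrtU p) = (sqrtU p)⁻¹ :=
  (Complex.inv_eq_conj norm_sqrtU).symm

theorem sqrtU_pow_three : sqrtU p ^ 3 = Complex.exp ((Real.pi / p : ℝ) * Complex.I) := by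
  rw [sqrtU, ← Complex.exp_nat_mul]
  congr 1
  push_cast
  ring

theorem sqrtU_pow_six : sqrtU p ^ 6 = Complex.exp (2 * Real.pi * Complex.I / p) := by
  rw [sqrtU, ← Complex.exp_nat_mul]
  congr 1
  push_cast
  ring

theorem inv_sqrtU_sq : (sqrtU p)⁻¹ ^ 2 = Complex.exp (-(2 * Real.pi * Complex.I / (3 * p))) := by
  rw [sqrtU, ← Complex.exp_neg, ← Complex.exp_nat_mul]
  congr 1
  push_cast
  ring

theorem phaseH_eq :
    phaseH p = -Complex.I * Complex.exp (-(Real.pi * Complex.I / (3 * p))) := by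
  rw [phaseH, sqrtU, Complex.exp_neg]

theorem norm_phaseH : ‖phaseH p‖ = 1 := by
  rw [phaseH, norm_mul, norm_neg, Complex.norm_I, norm_inv, norm_sqrtU, inv_one, one_mul]

theorem phaseH_ne_zero : phaseH p ≠ 0 := norm_ne_zero_iff.1 (norm_phaseH.trans_ne one_ne_zero)

theorem alphaH_eq : alphaH p = 2 * Real.sin (Real.pi / p) := by
  have hsin : 0 ≤ Real.sin (Real.pi / p) := by
    obtain rfl | hp := Nat.eq_zero_or_pos p
    · simp
    · exact Real.sin_nonneg_of_nonneg_of_le_pi (by positivity)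
        (div_le_self Real.pi_pos.le (by exact_mod_cast hp))
  rw [alphaH, show 2 - 2 * Real.cos (2 * Real.pi / p) = (2 * Real.sin (Real.pi / p)) ^ 2 by
    rw [mul_div_assoc, Real.cos_two_mul, Real.cos_sq']; ring, Real.sqrt_sq (by positivity)]

theorem alphaH_pos (hp : 2 ≤ p) : 0 < alphaH p := by
  have hp' : (1 : ℝ) < p := by exact_mod_cast hp
  rw [alphaH_eq]
  have := Real.sin_pos_of_pos_of_lt_pi (x := Real.pi / p) (by positivity)
    (div_lt_self Real.pi_pos hp')
  positivity

theorem sqrtU_pow_six_sub_one : sqrtU p ^ 6 - 1 = Complex.I * sqrtU p ^ 3 * alphaH p := by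
  rw [show sqrtU p ^ 6 = (sqrtU p ^ 3) ^ 2 by ring, sqrtU_pow_three, alphaH_eq, Complex.exp_mul_I]
  have hsc := Complex.sin_sq_add_cos_sq ((Real.pi / p : ℝ) : ℂ)
  push_cast at hsc ⊢
  linear_combination hsc - Complex.sin (Real.pi / p) ^ 2 * Complex.I_sq

theorem sqrtU_pow_six_ne_one (hp : 2 ≤ p) : sqrtU p ^ 6 ≠ 1 := by
  rw [← sub_ne_zero, sqrtU_pow_six_sub_one]
  exact mul_ne_zero (mul_ne_zero Complex.I_ne_zero (pow_ne_zero 3 sqrtU_ne_zero))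
    (Complex.ofReal_ne_zero.2 (alphaH_pos hp).ne')

theorem reflPart_mulVec (v z : Fin 3 → ℂ) :
    reflPart p v *ᵥ z = (Complex.I * sqrtU p ^ 3 * herm21 z v) • v := by
  rw [reflPart, Matrix.smul_mulVec, Matrix.vecMulVec_mulVec, dotProduct_comm, dotProduct_dualVec,
    op_smul_eq_smul, smul_smul]

theorem vecMul_reflPart_eq_zero {v y : Fin 3 → ℂ} (h : v ⬝ᵥ y = 0) : y ᵥ* reflPart p v = 0 := by
  rw [reflPart, Matrix.vecMul_smul, Matrix.vecMul_vecMulVec, dotProduct_comm, h, zero_smul,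
    smul_zero]

theorem trace_reflPart (v : Fin 3 → ℂ) :
    (reflPart p v).trace = Complex.I * sqrtU p ^ 3 * herm21 v v := by
  rw [reflPart, Matrix.trace_smul, Matrix.trace_vecMulVec, dotProduct_dualVec, smul_eq_mul]

theorem trace_reflPart_mul (v : Fin 3 → ℂ) (M : Matrix (Fin 3) (Fin 3) ℂ) :
    (reflPart p v * M).trace = Complex.I * sqrtU p ^ 3 * herm21 (M *ᵥ v) v := by
  rw [Matrix.trace_mul_comm, reflPart, mul_smul_comm, Matrix.trace_smul, Matrix.mul_vecMulVec,
    Matrix.trace_vecMulVec, dotProduct_dualVec, smul_eq_mul]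

theorem mul_reflPart {M : Matrix (Fin 3) (Fin 3) ℂ} {v : Fin 3 → ℂ} {s : ℂ}
    (h : M *ᵥ v = s • v) : M * reflPart p v = s • reflPart p v := by
  rw [reflPart, mul_smul_comm, Matrix.mul_vecMulVec, h, Matrix.smul_vecMulVec, smul_comm]

theorem reflPart_mul_reflPart_mul (v w : Fin 3 → ℂ) :
    reflPart p v * reflPart p w * reflPart p v =
      (-sqrtU p ^ 6 * (‖herm21 v w‖ : ℂ) ^ 2) • reflPart p v := by
  refine mul_reflPart ?_
  rw [← Matrix.mulVec_mulVec, reflPart_mulVec, reflPart_mulVec, herm21_smul_left,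
    ← herm21_mul_herm21_comm]
  congr 1
  linear_combination sqrtU p ^ 6 * herm21 v w * herm21 w v * Complex.I_sq

theorem reflPart_mulVec_self {v : Fin 3 → ℂ} (hv : herm21 v v = alphaH p) :
    reflPart p v *ᵥ v = (sqrtU p ^ 6 - 1) • v := by
  rw [reflPart_mulVec, hv, sqrtU_pow_six_sub_one]

theorem one_add_reflPart_mulVec_self {v : Fin 3 → ℂ} (hv : herm21 v v = alphaH p) :
    (1 + reflPart p v) *ᵥ v = sqrtU p ^ 6 • v := by
  rw [Matrix.add_mulVec, Matrix.one_mulVec, reflPart_mulVec_self hv, sub_smul, one_smul,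
    add_sub_cancel]

theorem isReflectionPair_reflPart {v w : Fin 3 → ℂ} (hv : herm21 v v = alphaH p)
    (hw : herm21 w w = alphaH p) :
    IsReflectionPair (sqrtU p ^ 6) (‖herm21 v w‖ : ℂ) (reflPart p v) (reflPart p w) :=
  ⟨mul_reflPart (reflPart_mulVec_self hv), mul_reflPart (reflPart_mulVec_self hw),
    reflPart_mul_reflPart_mul v w, by rw [norm_herm21_comm, reflPart_mul_reflPart_mul]⟩

theorem reflPart_mul_reflPart_eq_zero {v w : Fin 3 → ℂ} (h : herm21 w v = 0) :
    reflPart p v * reflPart p w = 0 := by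
  have hvw : reflPart p v *ᵥ w = 0 := by rw [reflPart_mulVec, h, mul_zero, zero_smul]
  rw [reflPart, reflPart, mul_smul_comm, Matrix.mul_vecMulVec, ← reflPart, hvw,
    Matrix.zero_vecMulVec, smul_zero]

theorem exists_eq_smul_of_one_add_reflPart_mulVec (hp : 2 ≤ p) {v w : Fin 3 → ℂ}
    (h : (1 + reflPart p v) *ᵥ w = sqrtU p ^ 6 • w) : ∃ s : ℂ, w = s • v := by
  rw [Matrix.add_mulVec, Matrix.one_mulVec, reflPart_mulVec] at h
  have hw : (sqrtU p ^ 6 - 1) • w = (Complex.I * sqrtU p ^ 3 * herm21 w v) • v := by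
    rw [sub_smul, one_smul, ← h, add_sub_cancel_left]
  exact ⟨_, ((inv_smul_eq_iff₀ (sub_ne_zero.2 (sqrtU_pow_six_ne_one hp))).2 hw.symm).symm.trans
    (smul_smul _ _ _)⟩

theorem exists_mulVec_eq_smul_of_intertwines (hp : 2 ≤ p) {M : Matrix (Fin 3) (Fin 3) ℂ}
    {v w : Fin 3 → ℂ} (hv : herm21 v v = alphaH p)
    (h : M * (1 + reflPart p v) = (1 + reflPart p w) * M) : ∃ s : ℂ, M *ᵥ v = s • w := by
  apply exists_eq_smul_of_one_add_reflPart_mulVec hp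
  rw [Matrix.mulVec_mulVec, ← h, ← Matrix.mulVec_mulVec, one_add_reflPart_mulVec_self hv,
    Matrix.mulVec_smul]

theorem ne_zero_of_herm21_self_eq_alphaH (hp : 2 ≤ p) {v : Fin 3 → ℂ}
    (hv : herm21 v v = alphaH p) : v ≠ 0 := by
  rintro rfl
  rw [herm21_zero_left] at hv
  exact (alphaH_pos hp).ne (by exact_mod_cast hv)

/-! ### Complex reflections and their parameters -/

theorem IsComplexReflection.herm21_self_ne_zero {v : Fin 3 → ℂ} {R : SU21}
    (h : IsComplexReflection p v R) : herm21 v v ≠ 0 := fun h0 =>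
  h.1.ne' (by rw [h0, Complex.zero_re])

theorem IsComplexReflection.coe_eq {v : Fin 3 → ℂ} {R : SU21} (h : IsComplexReflection p v R)
    (hv : herm21 v v = alphaH p) : R.1.1 = ((sqrtU p)⁻¹ ^ 2) • (1 + reflPart p v) := by
  have hα : (alphaH p : ℂ) ≠ 0 := hv ▸ h.herm21_self_ne_zero
  refine Matrix.ext_of_mulVec_single fun i => ?_
  rw [h.2, ← inv_sqrtU_sq, ← sqrtU_pow_six, Matrix.smul_mulVec, Matrix.add_mulVec,
    Matrix.one_mulVec, reflPart_mulVec, sqrtU_pow_six_sub_one, hv, mul_assoc _ (alphaH p : ℂ),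
    mul_div_cancel₀ _ hα]

theorem IsComplexReflection.smul {v : Fin 3 → ℂ} {R : SU21} (h : IsComplexReflection p v R) {s : ℂ}
    (hs : s ≠ 0) : IsComplexReflection p (s • v) R := by
  refine ⟨?_, fun z => ?_⟩
  · rw [herm21_smul_smul_self, Complex.re_ofReal_mul]
    have := h.1
    positivity
  · have hv := h.herm21_self_ne_zero
    have hs' : conj s ≠ 0 := (map_ne_zero _).2 hs
    rw [h.2, herm21_smul_left, herm21_smul_right, herm21_smul_right, smul_smul]
    congr 3
    field_simp

theorem exists_isComplexReflection_herm21_self_eq (hp : 2 ≤ p) {R : SU21}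
    (h : ∃ v, IsComplexReflection p v R) :
    ∃ v, IsComplexReflection p v R ∧ herm21 v v = alphaH p := by
  obtain ⟨v, hv⟩ := h
  have hq : 0 < alphaH p / (herm21 v v).re := div_pos (alphaH_pos hp) hv.1
  have hs : 0 < √(alphaH p / (herm21 v v).re) := Real.sqrt_pos.2 hq
  refine ⟨((√(alphaH p / (herm21 v v).re) : ℝ) : ℂ) • v,
    hv.smul (Complex.ofReal_ne_zero.2 hs.ne'), ?_⟩
  have hre : ((herm21 v v).re : ℂ) = herm21 v v := Complex.conj_eq_iff_re.1 (herm21_conj v v)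
  rw [herm21_smul_smul_self, Complex.norm_of_nonneg hs.le, Real.sq_sqrt hq.le, ← hre,
    Complex.ofReal_re, ← Complex.ofReal_mul, div_mul_cancel₀ _ hv.1.ne']

/-- The vectors `v₀, v₁, v₂` have the Gram matrix `hermitianH p ρ σ τ`, spelled out on the entries
that determine the others by Hermitian symmetry. -/
structure HasGramMatrix (p : ℕ) (v : Fin 3 → Fin 3 → ℂ) (ρ σ τ : ℂ) : Prop where
  self : ∀ i, herm21 (v i) (v i) = alphaH p
  one_zero : herm21 (v 1) (v 0) = phaseH p * ρ
  two_one : herm21 (v 2) (v 1) = phaseH p * σ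
  zero_two : herm21 (v 0) (v 2) = phaseH p * τ

theorem hasGramMatrix_iff {v : Fin 3 → Fin 3 → ℂ} {ρ σ τ : ℂ} :
    HasGramMatrix p v ρ σ τ ↔ ∀ i j, herm21 (v j) (v i) = hermitianH p ρ σ τ i j := by
  have hH : hermitianH p ρ σ τ = !![(alphaH p : ℂ), phaseH p * ρ, conj (phaseH p * τ);
      conj (phaseH p * ρ), alphaH p, phaseH p * σ;
      phaseH p * τ, conj (phaseH p * σ), alphaH p] := by
    rw [phaseH_eq, hermitianH, alphaH]
  rw [hH]
  constructor
  · intro h i j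
    have h₀₁ := herm21_conj (v 1) (v 0)
    have h₁₂ := herm21_conj (v 2) (v 1)
    have h₂₀ := herm21_conj (v 0) (v 2)
    rw [h.one_zero] at h₀₁
    rw [h.two_one] at h₁₂
    rw [h.zero_two] at h₂₀
    fin_cases i <;> fin_cases j
    exacts [h.self 0, h.one_zero, h₂₀.symm, h₀₁.symm, h.self 1, h.two_one, h.zero_two, h₁₂.symm,
      h.self 2]
  · intro h
    refine ⟨fun i => ?_, h 0 1, h 1 2, h 2 0⟩
    fin_cases i
    exacts [h 0 0, h 1 1, h 2 2]

theorem exists_hasParameters (hp : 2 ≤ p) {R₁ R₂ R₃ : SU21} (hR₁ : ∃ v, IsComplexReflection p v R₁)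
    (hR₂ : ∃ v, IsComplexReflection p v R₂) (hR₃ : ∃ v, IsComplexReflection p v R₃) :
    ∃ (ρ : ℂ) (σ τ : ℝ), 0 ≤ σ ∧ 0 ≤ τ ∧ HasParameters p R₁ R₂ R₃ ρ σ τ := by
  obtain ⟨w₁, h₁, n₁⟩ := exists_isComplexReflection_herm21_self_eq hp hR₁
  obtain ⟨w₂, h₂, n₂⟩ := exists_isComplexReflection_herm21_self_eq hp hR₂
  obtain ⟨w₃, h₃, n₃⟩ := exists_isComplexReflection_herm21_self_eq hp hR₃
  obtain ⟨e₁, he₁, hτ⟩ := exists_norm_eq_one_herm21_smul_eq w₁ w₃ (norm_phaseH (p := p))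
  obtain ⟨e₂, he₂, hσ⟩ := exists_norm_eq_one_herm21_smul_eq w₂ w₃
    ((RCLike.norm_conj (phaseH p)).trans norm_phaseH)
  have hsmul {e : ℂ} {w : Fin 3 → ℂ} (he : ‖e‖ = 1) (hw : herm21 w w = alphaH p) :
      herm21 (e • w) (e • w) = alphaH p := by
    rw [herm21_smul_smul_self, he, hw, one_pow, Complex.ofReal_one, one_mul]
  have hne {e : ℂ} (he : ‖e‖ = 1) : e ≠ 0 := norm_ne_zero_iff.1 (he.trans_ne one_ne_zero)
  refine ⟨herm21 (e₂ • w₂) (e₁ • w₁) / phaseH p, ‖herm21 w₂ w₃‖, ‖herm21 w₁ w₃‖, norm_nonneg _,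
    norm_nonneg _, ![e₁ • w₁, e₂ • w₂, w₃], h₁.smul (hne he₁), h₂.smul (hne he₂), h₃,
    hasGramMatrix_iff.1 ⟨fun i => ?_, (mul_div_cancel₀ _ phaseH_ne_zero).symm, ?_, hτ⟩⟩
  · fin_cases i
    exacts [hsmul he₁ n₁, hsmul he₂ n₂, n₃]
  · refine (herm21_conj (e₂ • w₂) w₃).symm.trans ?_
    rw [hσ, map_mul, Complex.conj_conj, Complex.conj_ofReal]

/-- The inclusion of `SU(2,1)` in the ring of matrices. -/
noncomputable def su21ToMatrix : SU21 →* Matrix (Fin 3) (Fin 3) ℂ where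
  toFun R := R.1.1
  map_one' := rfl
  map_mul' _ _ := rfl

theorem su21ToMatrix_injective : Function.Injective su21ToMatrix := fun _ _ h =>
  Subtype.ext (Subtype.ext h)

theorem altProd_eq_iff_braidDiff_eq_zero {v w : Fin 3 → ℂ} {A B : SU21}
    (hA : IsComplexReflection p v A) (hB : IsComplexReflection p w B)
    (hv : herm21 v v = alphaH p) (hw : herm21 w w = alphaH p) (l : ℕ) :
    altProd A B l = altProd B A l ↔ braidDiff (reflPart p v) (reflPart p w) l = 0 := by
  have hA' : su21ToMatrix A = _ := hA.coe_eq hv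
  have hB' : su21ToMatrix B = _ := hB.coe_eq hw
  rw [← su21ToMatrix_injective.eq_iff, map_altProd, map_altProd, hA', hB', altMul_smul,
    altMul_smul, braidDiff, sub_eq_zero]
  exact (smul_right_injective _ (pow_ne_zero l inv_sqrtU_sq_ne_zero)).eq_iff

theorem herm21_ne_zero_of_braidDiff_two_ne_zero {v w : Fin 3 → ℂ}
    (h : braidDiff (reflPart p v) (reflPart p w) 2 ≠ 0) : herm21 v w ≠ 0 := by
  contrapose! h
  have h' : herm21 w v = 0 := by rw [← herm21_conj, h, map_zero]
  simp only [braidDiff, altMul, mul_one, mul_add, add_mul, one_mul,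
    reflPart_mul_reflPart_eq_zero h, reflPart_mul_reflPart_eq_zero h']
  abel

theorem HasBraidLength.exists_norm_herm21_eq {v w : Fin 3 → ℂ} {A B : SU21} {m : ℕ}
    (hbr : HasBraidLength A B m) (hA : IsComplexReflection p v A) (hB : IsComplexReflection p w B)
    (hv : herm21 v v = alphaH p) (hw : herm21 w w = alphaH p) (hm : 3 ≤ m) :
    ∃ k : ℕ, 0 < k ∧ 2 * k < m ∧ k.Coprime m ∧ ‖herm21 v w‖ = 2 * Real.cos (k * Real.pi / m) := by
  have hiff := altProd_eq_iff_braidDiff_eq_zero hA hB hv hw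
  have hmin (l : ℕ) (h₁ : 1 ≤ l) (h₂ : l < m) :
      braidDiff (reflPart p v) (reflPart p w) l ≠ 0 := fun h =>
    h₂.not_ge (hbr.2 ⟨h₁, (hiff l).2 h⟩)
  have hvw := herm21_ne_zero_of_braidDiff_two_ne_zero (hmin 2 (by norm_num) hm)
  exact (isReflectionPair_reflPart hv hw).exists_eq_two_mul_cos (pow_ne_zero 6 sqrtU_ne_zero)
    (norm_pos_iff.2 hvw) hm hmin ((hiff m).1 hbr.1.2)

end

/-! ### The spectrum of the symmetry -/

theorem pow_eq_one_of_mem_spectrum {K A : Type*} [Field K] [Ring A] [Nontrivial A] [Algebra K A]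
    {S : A} {N : ℕ} (hS : S ^ N = 1) {a : K} (ha : a ∈ spectrum K S) : a ^ N = 1 := by
  have h := spectrum.pow_mem_pow S N ha
  rwa [hS, spectrum.one_eq] at h

section

variable {K : Type*} [Field K]

theorem mem_spectrum_of_vecMul {n : Type*} [Fintype n] [DecidableEq n] {A : Matrix n n K}
    {y : n → K} (hy : y ≠ 0) {k : K} (h : y ᵥ* A = k • y) : k ∈ spectrum K A := fun hu =>
  hy (Matrix.vecMul_injective_iff_isUnit.2 hu (by
    simp only [Matrix.vecMul_sub, h, Matrix.zero_vecMul, Algebra.algebraMap_eq_smul_one,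
      Matrix.vecMul_smul, Matrix.vecMul_one, sub_self, smul_zero]))

theorem mem_spectrum_of_mulVec {n : Type*} [Fintype n] [DecidableEq n] {A : Matrix n n K}
    {y : n → K} (hy : y ≠ 0) {k : K} (h : A *ᵥ y = k • y) : k ∈ spectrum K A := fun hu =>
  hy (Matrix.mulVec_injective_iff_isUnit.2 hu (by
    simp only [Matrix.sub_mulVec, h, Matrix.mulVec_zero, Algebra.algebraMap_eq_smul_one,
      Matrix.smul_mulVec, Matrix.one_mulVec, sub_self]))

theorem two_mul_det_one_sub {R : Type*} [CommRing R] (A : Matrix (Fin 3) (Fin 3) R) :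
    2 * (1 - A).det = 2 - 2 * A.trace + (A.trace ^ 2 - (A * A).trace) - 2 * A.det := by
  simp only [Matrix.det_fin_three, Matrix.trace_fin_three, Matrix.mul_apply, Fin.sum_univ_three,
    Matrix.sub_apply, Matrix.one_apply]
  simp
  ring

theorem exists_spectrum_eq_of_mem [IsAlgClosed K] {A : Matrix (Fin 3) (Fin 3) K} {k : K}
    (hk : k ∈ spectrum K A) :
    ∃ m₁ m₂ : K, spectrum K A = {k, m₁, m₂} ∧ A.trace = k + m₁ + m₂ ∧ A.det = k * m₁ * m₂ ∧
      (A * A).trace = k ^ 2 + m₁ ^ 2 + m₂ ^ 2 := by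
  have hmem (a : K) : a ∈ spectrum K A ↔ a ∈ A.charpoly.roots := by
    rw [Matrix.mem_spectrum_iff_isRoot_charpoly, Polynomial.mem_roots A.charpoly_monic.ne_zero]
  obtain ⟨s, hs⟩ := Multiset.exists_cons_of_mem ((hmem k).1 hk)
  have hcard : Multiset.card A.charpoly.roots = 3 := by
    rw [IsAlgClosed.card_roots_eq_natDegree, Matrix.charpoly_natDegree_eq_dim, Fintype.card_fin]
  rw [hs, Multiset.card_cons] at hcard
  obtain ⟨m₁, m₂, rfl⟩ := Multiset.card_eq_two.1 (Nat.succ_injective hcard)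
  have htr : A.trace = k + m₁ + m₂ := by
    rw [A.trace_eq_sum_roots_charpoly, hs, Multiset.sum_cons, Multiset.sum_pair, add_assoc]
  have hdet : A.det = k * m₁ * m₂ := by
    rw [A.det_eq_prod_roots_charpoly, hs, Multiset.prod_cons, Multiset.prod_pair, mul_assoc]
  have hone : (1 - A).det = (1 - k) * (1 - m₁) * (1 - m₂) := by
    rw [← map_one (Matrix.scalar (Fin 3)), ← Matrix.eval_charpoly,
      (IsAlgClosed.splits A.charpoly).eval_eq_prod_roots_of_monic A.charpoly_monic, hs]
    simp [mul_assoc]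
  refine ⟨m₁, m₂, Set.ext fun a => ?_, htr, hdet, ?_⟩
  · simp [hmem, hs]
  · have h := two_mul_det_one_sub A
    rw [hone, htr, hdet] at h
    linear_combination h

end

/-- The properties of `J = R₁⁻¹S`, as a matrix `M`: it is an isometry of determinant one, its
square is `R₃`, and it conjugates `R₁` to `R₂`, where `Rᵢ₊₁` is the reflection with polar vector
`v i`. -/
structure IsConjugatingRoot (p : ℕ) (v : Fin 3 → Fin 3 → ℂ) (M : Matrix (Fin 3) (Fin 3) ℂ) :
    Prop where
  isometry : ∀ z w, herm21 (M *ᵥ z) (M *ᵥ w) = herm21 z w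
  det_eq_one : M.det = 1
  mul_self : M * M = ((sqrtU p)⁻¹ ^ 2) • (1 + reflPart p (v 2))
  intertwines : M * (1 + reflPart p (v 0)) = (1 + reflPart p (v 1)) * M

section

variable {p : ℕ} {v : Fin 3 → Fin 3 → ℂ} {M : Matrix (Fin 3) (Fin 3) ℂ} {ρ : ℂ} {ε c : ℂ}

theorem conj_eq_self_of_eq_one_or_neg_one (hε : ε = 1 ∨ ε = -1) : conj ε = ε := by
  rcases hε with rfl | rfl <;> simp

theorem IsConjugatingRoot.exists_mulVec_two_eq (hM : IsConjugatingRoot p v M) (hp : 2 ≤ p)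
    (hv : herm21 (v 2) (v 2) = alphaH p) :
    ∃ ε : ℂ, (ε = 1 ∨ ε = -1) ∧ M *ᵥ v 2 = (ε * sqrtU p ^ 2) • v 2 := by
  have hx := sqrtU_ne_zero (p := p)
  have hR₃ : 1 + reflPart p (v 2) = sqrtU p ^ 2 • (M * M) := by
    rw [hM.mul_self, smul_smul, inv_pow, mul_inv_cancel₀ (pow_ne_zero 2 hx), one_smul]
  have hcomm : M * (1 + reflPart p (v 2)) = (1 + reflPart p (v 2)) * M := by
    rw [hR₃, smul_mul_assoc, mul_smul_comm, mul_assoc]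
  obtain ⟨s, hs⟩ := exists_mulVec_eq_smul_of_intertwines hp hv hcomm
  have hsq : s ^ 2 = (sqrtU p ^ 2) ^ 2 := by
    have hMM : (M * M) *ᵥ v 2 = s ^ 2 • v 2 := by
      rw [← Matrix.mulVec_mulVec, hs, Matrix.mulVec_smul, hs, smul_smul, sq]
    rw [hM.mul_self, Matrix.smul_mulVec, one_add_reflPart_mulVec_self hv, smul_smul] at hMM
    rw [← smul_left_injective ℂ (ne_zero_of_herm21_self_eq_alphaH hp hv) hMM]
    field_simp
  rcases sq_eq_sq_iff_eq_or_eq_neg.1 hsq with rfl | rfl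
  · exact ⟨1, Or.inl rfl, by rw [hs, one_mul]⟩
  · exact ⟨-1, Or.inr rfl, by rw [hs, neg_one_mul]⟩

theorem IsConjugatingRoot.exists_mulVec_zero_eq (hM : IsConjugatingRoot p v M) (hp : 2 ≤ p)
    (h₀ : herm21 (v 0) (v 0) = alphaH p) (h₁ : herm21 (v 1) (v 1) = alphaH p) :
    ∃ c : ℂ, ‖c‖ = 1 ∧ M *ᵥ v 0 = c • v 1 := by
  obtain ⟨c, hc⟩ := exists_mulVec_eq_smul_of_intertwines hp h₀ hM.intertwines
  have hα : (alphaH p : ℂ) ≠ 0 := Complex.ofReal_ne_zero.2 (alphaH_pos hp).ne'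
  have hiso := hM.isometry (v 0) (v 0)
  rw [hc, herm21_smul_smul_self, h₀, h₁, mul_eq_right₀ hα, Complex.ofReal_eq_one] at hiso
  exact ⟨c, (pow_eq_one_iff_of_nonneg (norm_nonneg _) two_ne_zero).1 hiso, hc⟩

theorem IsConjugatingRoot.eq_neg_mul_conj {σ τ : ℂ} (hM : IsConjugatingRoot p v M)
    (hv : HasGramMatrix p v ρ σ τ) (hε : ε = 1 ∨ ε = -1)
    (h₂ : M *ᵥ v 2 = (ε * sqrtU p ^ 2) • v 2) (h₀ : M *ᵥ v 0 = c • v 1) :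
    τ = -(ε * c) * conj σ := by
  have hx := sqrtU_ne_zero (p := p)
  have hiso := hM.isometry (v 0) (v 2)
  rw [h₀, h₂, herm21_smul_left, herm21_smul_right, ← herm21_conj (v 2), hv.two_one, hv.zero_two,
    phaseH, map_mul, map_mul, map_mul, map_neg, map_pow, map_inv₀, conj_sqrtU, Complex.conj_I,
    conj_eq_self_of_eq_one_or_neg_one hε] at hiso
  field_simp at hiso
  linear_combination hiso

theorem IsConjugatingRoot.eq_and_exists_mulVec_eq {σ τ : ℝ} (hM : IsConjugatingRoot p v M)
    (hp : 2 ≤ p) (hv : HasGramMatrix p v ρ σ τ) (hσ : 0 ≤ σ) (hτ : 0 < τ) :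
    σ = τ ∧ ∃ ε : ℂ, (ε = 1 ∨ ε = -1) ∧ M *ᵥ v 2 = (ε * sqrtU p ^ 2) • v 2 ∧
      M *ᵥ v 0 = (-ε) • v 1 := by
  obtain ⟨ε, hε, h₂⟩ := hM.exists_mulVec_two_eq hp (hv.self 2)
  obtain ⟨c, hc, h₀⟩ := hM.exists_mulVec_zero_eq hp (hv.self 0) (hv.self 1)
  have hτσ := hM.eq_neg_mul_conj hv hε h₂ h₀
  rw [Complex.conj_ofReal] at hτσ
  have hεn : ‖ε‖ = 1 := by rcases hε with rfl | rfl <;> simp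
  obtain rfl : σ = τ := by
    simpa [hεn, hc, abs_of_nonneg hσ, abs_of_pos hτ] using (congrArg norm hτσ).symm
  refine ⟨rfl, ε, hε, h₂, ?_⟩
  have hεc : -(ε * c) = 1 := (mul_eq_right₀ (Complex.ofReal_ne_zero.2 hτ.ne')).1 hτσ.symm
  obtain rfl : c = -ε := by
    rcases hε with rfl | rfl
    · linear_combination -hεc
    · linear_combination hεc
  exact h₀

theorem IsConjugatingRoot.conj_add_self_eq {σ τ : ℂ} (hM : IsConjugatingRoot p v M)
    (hv : HasGramMatrix p v ρ σ τ) (hε : ε = 1 ∨ ε = -1) (h₀ : M *ᵥ v 0 = (-ε) • v 1) :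
    conj ρ + ρ = conj (σ * τ) := by
  have hx := sqrtU_ne_zero (p := p)
  have hε₂ : ε * ε = 1 := by rcases hε with rfl | rfl <;> norm_num
  have hεc := conj_eq_self_of_eq_one_or_neg_one hε
  have h₁ : M *ᵥ v 1 = (-ε) • (sqrtU p)⁻¹ ^ 2 •
      (v 0 + (Complex.I * sqrtU p ^ 3 * herm21 (v 0) (v 2)) • v 2) := by
    rw [← reflPart_mulVec, ← Matrix.one_mulVec (v 0), Matrix.mulVec_mulVec, mul_one,
      ← Matrix.add_mulVec, ← Matrix.smul_mulVec, ← hM.mul_self, ← Matrix.mulVec_mulVec, h₀,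
      Matrix.mulVec_smul, smul_smul, neg_mul_neg, hε₂, one_smul]
  have hiso := hM.isometry (v 0) (v 1)
  rw [h₀, h₁, herm21_smul_left, herm21_smul_right, herm21_smul_right, herm21_add_right,
    herm21_smul_right, ← herm21_conj (v 1) (v 0), ← herm21_conj (v 2) (v 1), hv.one_zero,
    hv.two_one, hv.zero_two, phaseH] at hiso
  simp only [map_mul, map_neg, map_pow, map_inv₀, Complex.conj_I, conj_sqrtU, hεc, inv_inv,
    neg_neg] at hiso
  rw [map_mul]
  field_simp at hiso
  linear_combination -hiso + (-ρ - Complex.I ^ 2 * conj σ * conj τ) * hε₂ -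
    conj σ * conj τ * Complex.I_sq

theorem IsConjugatingRoot.exists_spectrum_eq (hM : IsConjugatingRoot p v M) (hp : 2 ≤ p)
    (hv : herm21 (v 2) (v 2) = alphaH p) (hε : ε = 1 ∨ ε = -1)
    (h₂ : M *ᵥ v 2 = (ε * sqrtU p ^ 2) • v 2) :
    ∃ μ : ℂ, μ ^ 2 = (sqrtU p)⁻¹ ^ 2 ∧ spectrum ℂ M = {ε * sqrtU p ^ 2, μ, ε * μ} ∧
      M.trace = ε * sqrtU p ^ 2 + μ + ε * μ := by
  have hx := sqrtU_ne_zero (p := p)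
  have hε₂ : ε * ε = 1 := by rcases hε with rfl | rfl <;> norm_num
  obtain ⟨μ, m, hspec, htr, hdet, htr₂⟩ := exists_spectrum_eq_of_mem
    (mem_spectrum_of_mulVec (ne_zero_of_herm21_self_eq_alphaH hp hv) h₂)
  have hsum : μ ^ 2 + m ^ 2 = 2 * (sqrtU p)⁻¹ ^ 2 := by
    rw [hM.mul_self, Matrix.trace_smul, Matrix.trace_add, trace_reflPart, hv,
      ← sqrtU_pow_six_sub_one, Matrix.trace_one, Fintype.card_fin, smul_eq_mul] at htr₂
    field_simp at htr₂ ⊢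
    push_cast at htr₂
    linear_combination -htr₂ - sqrtU p ^ 6 * hε₂
  have hprod : μ * m = ε * (sqrtU p)⁻¹ ^ 2 := by
    rw [hM.det_eq_one] at hdet
    field_simp
    linear_combination -ε * hdet - μ * m * sqrtU p ^ 2 * hε₂
  obtain rfl : m = ε * μ := by
    have hsq : (m - ε * μ) ^ 2 = 0 := by
      linear_combination hsum - 2 * ε * hprod + (μ ^ 2 - 2 * (sqrtU p)⁻¹ ^ 2) * hε₂
    exact sub_eq_zero.1 (pow_eq_zero_iff two_ne_zero |>.1 hsq)
  exact ⟨μ, by linear_combination ε * hprod + ((sqrtU p)⁻¹ ^ 2 - μ ^ 2) * hε₂, hspec, htr⟩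

/-- The matrix of `S = R₁J`, where `M` is the matrix of `J`. -/
noncomputable def symmetryMatrix (p : ℕ) (v : Fin 3 → Fin 3 → ℂ) (M : Matrix (Fin 3) (Fin 3) ℂ) :
    Matrix (Fin 3) (Fin 3) ℂ :=
  ((sqrtU p)⁻¹ ^ 2) • (1 + reflPart p (v 0)) * M

theorem trace_symmetryMatrix {σ τ : ℂ} (hv : HasGramMatrix p v ρ σ τ)
    (h₀ : M *ᵥ v 0 = (-ε) • v 1) :
    (symmetryMatrix p v M).trace = (sqrtU p)⁻¹ ^ 2 * M.trace - ε * ρ := by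
  have hx := sqrtU_ne_zero (p := p)
  rw [symmetryMatrix, smul_mul_assoc, Matrix.trace_smul, add_mul, one_mul, Matrix.trace_add,
    trace_reflPart_mul, h₀, herm21_smul_left, hv.one_zero, smul_eq_mul, phaseH]
  field_simp
  linear_combination ε * ρ * sqrtU p ^ 2 * Complex.I_sq

theorem exists_ne_zero_dotProduct_eq_zero_and {K : Type*} [Field K] (a b : Fin 3 → K) :
    ∃ y : Fin 3 → K, y ≠ 0 ∧ a ⬝ᵥ y = 0 ∧ b ⬝ᵥ y = 0 := by
  have hdet : (Matrix.of ![a, b, b]).det = 0 :=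
    Matrix.det_zero_of_row_eq (i := 1) (j := 2) (by decide) rfl
  obtain ⟨y, hy, hy₀⟩ := Matrix.exists_mulVec_eq_zero_iff.2 hdet
  exact ⟨y, hy, congrFun hy₀ 0, congrFun hy₀ 1⟩

/- A vector `y` with `y ⬝ᵥ v 0 = y ⬝ᵥ v 2 = 0` is a left eigenvector of `R₁`, and of `M` because
`-μ` is not an eigenvalue of `M`. -/
theorem IsConjugatingRoot.mem_spectrum_symmetryMatrix (hM : IsConjugatingRoot p v M) {μ : ℂ}
    (hμ : μ ^ 2 = (sqrtU p)⁻¹ ^ 2) (hspec : -μ ∉ spectrum ℂ M) :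
    (sqrtU p)⁻¹ ^ 2 * μ ∈ spectrum ℂ (symmetryMatrix p v M) := by
  obtain ⟨y, hy, hy₀, hy₂⟩ := exists_ne_zero_dotProduct_eq_zero_and (v 0) (v 2)
  have hu : IsUnit (M + μ • (1 : Matrix (Fin 3) (Fin 3) ℂ)) := by
    rwa [spectrum.notMem_iff, Algebra.algebraMap_eq_smul_one, neg_smul, ← neg_add', IsUnit.neg_iff,
      add_comm] at hspec
  have hyM : y ᵥ* M = μ • y := by
    refine sub_eq_zero.1 (Matrix.vecMul_injective_iff_isUnit.2 hu ?_)
    have hsq : y ᵥ* (M * M) = μ ^ 2 • y := by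
      rw [hM.mul_self, Matrix.vecMul_smul, Matrix.vecMul_add, Matrix.vecMul_one,
        vecMul_reflPart_eq_zero hy₂, add_zero, hμ]
    simp only [Matrix.vecMul_add, Matrix.sub_vecMul, Matrix.vecMul_vecMul, hsq, Matrix.smul_vecMul,
      Matrix.vecMul_smul, Matrix.vecMul_one, Matrix.zero_vecMul, sq]
    module
  refine mem_spectrum_of_vecMul hy ?_
  rw [symmetryMatrix, ← Matrix.vecMul_vecMul, Matrix.vecMul_smul, Matrix.vecMul_add,
    Matrix.vecMul_one, vecMul_reflPart_eq_zero hy₀, add_zero, Matrix.smul_vecMul, hyM, smul_smul]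

theorem IsConjugatingRoot.exists_sum_of_roots_of_unity {σ τ : ℂ} {N : ℕ}
    (hM : IsConjugatingRoot p v M) (hp : 2 ≤ p) (hv : HasGramMatrix p v ρ σ τ)
    (hε : ε = 1 ∨ ε = -1) (h₂ : M *ᵥ v 2 = (ε * sqrtU p ^ 2) • v 2)
    (h₀ : M *ᵥ v 0 = (-ε) • v 1) (hdet : (symmetryMatrix p v M).det = 1)
    (hN : symmetryMatrix p v M ^ N = 1) :
    ∃ a b c : ℂ, a ^ (2 * N) = 1 ∧ b ^ (2 * N) = 1 ∧ c ^ (2 * N) = 1 ∧ a * b * c = 1 ∧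
      ρ - 1 = a + b + c := by
  have hx := sqrtU_ne_zero (p := p)
  have hpow {a : ℂ} (ha : a ∈ spectrum ℂ (symmetryMatrix p v M)) : a ^ (2 * N) = 1 := by
    rw [mul_comm, pow_mul, pow_eq_one_of_mem_spectrum hN ha, one_pow]
  have htr := trace_symmetryMatrix hv h₀
  obtain ⟨μ, hμ, hspecM, htrM⟩ := hM.exists_spectrum_eq hp (hv.self 2) hε h₂
  rw [htrM] at htr
  rcases hε with rfl | rfl
  · have hμ₀ : μ ≠ 0 := fun h => pow_ne_zero 2 (inv_ne_zero hx) (by rw [← hμ, h]; norm_num)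
    have hnot : -μ ∉ spectrum ℂ M := by
      rw [hspecM, one_mul, one_mul]
      rintro (h | h | h)
      · apply sqrtU_pow_six_ne_one hp
        rw [← neg_sq, h] at hμ
        field_simp at hμ
        exact hμ
      all_goals exact hμ₀ (self_eq_neg.1 (Eq.symm h))
    obtain ⟨k, hk⟩ : ∃ k, k = (sqrtU p)⁻¹ ^ 2 * μ := ⟨_, rfl⟩
    have hkS := hk ▸ hM.mem_spectrum_symmetryMatrix hμ hnot
    obtain ⟨m₁, m₂, hspec, htrS, hdetS, -⟩ := exists_spectrum_eq_of_mem hkS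
    refine ⟨k, -m₁, -m₂, hpow hkS, ?_, ?_, ?_, ?_⟩
    · rw [(even_two_mul N).neg_pow, hpow (by simp [hspec])]
    · rw [(even_two_mul N).neg_pow, hpow (by simp [hspec])]
    · rw [mul_neg, mul_neg, neg_mul, neg_neg, ← hdetS, hdet]
    · have hxx : (sqrtU p)⁻¹ ^ 2 * sqrtU p ^ 2 = 1 := by
        rw [← mul_pow, inv_mul_cancel₀ hx, one_pow]
      linear_combination htr - htrS - 2 * hk + hxx
  · obtain ⟨a, ha⟩ := spectrum.nonempty_of_isAlgClosed_of_finiteDimensional ℂ (symmetryMatrix p v M)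
    obtain ⟨b, c, hspec, htrS, hdetS, -⟩ := exists_spectrum_eq_of_mem ha
    refine ⟨a, b, c, hpow ha, hpow (by simp [hspec]), hpow (by simp [hspec]), hdetS ▸ hdet, ?_⟩
    rw [← htrS, htr]
    field_simp
    ring

end

/-! ### Reading off the braid lengths -/

section

variable {l n k m N : ℕ} {a b c ρ : ℂ}

theorem eq_of_cos_eq_of_coprime {a b : ℕ} (hl : 0 < l) (hln : 2 * l < n) (hc : l.Coprime n)
    (ha : 0 < a) (hab : 2 * a < b) (hc' : a.Coprime b)
    (h : Real.cos (2 * (l * Real.pi / n)) = Real.cos (2 * (a * Real.pi / b))) : n = b := by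
  have mem {x y : ℕ} (hxy : 2 * x < y) : 2 * ((x : ℝ) * Real.pi / y) ∈ Set.Icc 0 Real.pi := by
    have hy : (0 : ℝ) < y := by exact_mod_cast (by omega : 0 < y)
    have hxy' : (2 * x : ℝ) < y := by exact_mod_cast hxy
    refine ⟨by positivity, ?_⟩
    rw [← mul_div_assoc, div_le_iff₀ hy]
    nlinarith [Real.pi_pos]
  have hangle := Real.injOn_cos (mem hln) (mem hab) h
  have hn : (n : ℝ) ≠ 0 := by exact_mod_cast (by omega : n ≠ 0)
  have hb : (b : ℝ) ≠ 0 := by exact_mod_cast (by omega : b ≠ 0)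
  have hcross : l * b = n * a := by
    field_simp at hangle
    exact_mod_cast hangle
  exact Nat.dvd_antisymm (hc.symm.dvd_of_dvd_mul_left ⟨a, hcross⟩)
    (hc'.symm.dvd_of_dvd_mul_left ⟨l, by rw [mul_comm b, hcross, mul_comm]⟩)

theorem eq_three_of_two_mul_cos_eq_neg_one (hl : 0 < l) (hln : 2 * l < n) (hc : l.Coprime n)
    (h : 2 * Real.cos (2 * (l * Real.pi / n)) = -1) : n = 3 := by
  refine eq_of_cos_eq_of_coprime hl hln hc (a := 1) (by simp) (by simp) (by simp) ?_
  rw [Real.cos_two_mul (((1 : ℕ) : ℝ) * Real.pi / (3 : ℕ)), Nat.cast_one, one_mul,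
    Nat.cast_ofNat, Real.cos_pi_div_three]
  linarith

theorem eq_four_of_two_mul_cos_eq_zero (hl : 0 < l) (hln : 2 * l < n) (hc : l.Coprime n)
    (h : 2 * Real.cos (2 * (l * Real.pi / n)) = 0) : n = 4 := by
  refine eq_of_cos_eq_of_coprime hl hln hc (a := 1) (by simp) (by simp) (by simp) ?_
  rw [show 2 * (((1 : ℕ) : ℝ) * Real.pi / (4 : ℕ)) = Real.pi / 2 by push_cast; ring,
    Real.cos_pi_div_two]
  linarith

theorem eq_five_of_sq_add_two_mul_cos_eq_one (hl : 0 < l) (hln : 2 * l < n) (hc : l.Coprime n)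
    (h : (2 * Real.cos (2 * (l * Real.pi / n))) ^ 2 + 2 * Real.cos (2 * (l * Real.pi / n)) = 1) :
    n = 5 := by
  have h5 := Real.sq_sqrt (show (0 : ℝ) ≤ 5 by norm_num)
  have hroots : (Real.cos (2 * (l * Real.pi / n)) - (√5 - 1) / 4) *
      (Real.cos (2 * (l * Real.pi / n)) - -(1 + √5) / 4) = 0 := by
    linear_combination h / 4 - h5 / 16
  rcases mul_eq_zero.1 hroots with hcos | hcos
  · refine eq_of_cos_eq_of_coprime hl hln hc (a := 1) (by simp) (by simp) (by simp) ?_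
    rw [sub_eq_zero.1 hcos, Real.cos_two_mul, Nat.cast_one, one_mul, Nat.cast_ofNat,
      Real.cos_pi_div_five]
    linear_combination -h5 / 8
  · refine eq_of_cos_eq_of_coprime hl hln hc (a := 2) (by simp) (by simp) (by norm_num) ?_
    rw [show 2 * (((2 : ℕ) : ℝ) * Real.pi / (5 : ℕ)) = Real.pi - Real.pi / 5 by push_cast; ring,
      Real.cos_pi_sub, Real.cos_pi_div_five]
    linarith

theorem eq_six_of_two_mul_cos_eq_one (hl : 0 < l) (hln : 2 * l < n) (hc : l.Coprime n)
    (h : 2 * Real.cos (2 * (l * Real.pi / n)) = 1) : n = 6 := by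
  refine eq_of_cos_eq_of_coprime hl hln hc (a := 1) (by simp) (by simp) (by simp) ?_
  rw [show 2 * (((1 : ℕ) : ℝ) * Real.pi / (6 : ℕ)) = Real.pi / 3 by push_cast; ring,
    Real.cos_pi_div_three]
  linarith

theorem eq_eight_of_sq_two_mul_cos_eq_two (hl : 0 < l) (hln : 2 * l < n) (hc : l.Coprime n)
    (h : (2 * Real.cos (2 * (l * Real.pi / n))) ^ 2 = 2) : n = 8 := by
  have h2 := Real.sq_sqrt (show (0 : ℝ) ≤ 2 by norm_num)
  have hroots : (Real.cos (2 * (l * Real.pi / n)) - √2 / 2) *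
      (Real.cos (2 * (l * Real.pi / n)) + √2 / 2) = 0 := by
    linear_combination h / 4 - h2 / 4
  rcases mul_eq_zero.1 hroots with hcos | hcos
  · refine eq_of_cos_eq_of_coprime hl hln hc (a := 1) (by simp) (by simp) (by simp) ?_
    rw [show 2 * (((1 : ℕ) : ℝ) * Real.pi / (8 : ℕ)) = Real.pi / 4 by push_cast; ring,
      Real.cos_pi_div_four]
    linarith
  · refine eq_of_cos_eq_of_coprime hl hln hc (a := 3) (by simp) (by simp) (by norm_num) ?_
    rw [show 2 * (((3 : ℕ) : ℝ) * Real.pi / (8 : ℕ)) = Real.pi - Real.pi / 4 by push_cast; ring,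
      Real.cos_pi_sub, Real.cos_pi_div_four]
    linarith

/-- The pairs of braid lengths `(n, m)` allowed by the theorem. -/
def IsBraidPair (n m : ℕ) : Prop :=
  (n, m) = (3, 4) ∨ (n, m) = (3, 5) ∨ (n, m) = (4, 3) ∨ (n, m) = (5, 4) ∨ (n, m) = (8, 6) ∨
    ∃ k : ℕ, 3 ≤ k ∧ (n, m) = (k, k)

theorem isBraidPair_of_isTracePair (hl : 0 < l) (hln : 2 * l < n) (hlc : l.Coprime n) (hk : 0 < k)
    (hkm : 2 * k < m) (hkc : k.Coprime m) {t W : ℝ} (ht : 2 * Real.cos (2 * (l * Real.pi / n)) = t)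
    (hW : 2 * Real.cos (2 * (k * Real.pi / m)) = W)
    (h : IsTracePair (t : ℂ) ((1 + W - t : ℝ) : ℂ)) : IsBraidPair n m := by
  have h' : 1 + W - t = 1 ∨ (t = 0 ∧ 1 + W - t = 0) ∨ (t ^ 2 = 2 ∧ 1 + W - t = 2 - t) ∨
      (t = -1 ∧ 1 + W - t = 2) ∨ (t = -1 ∧ (1 + W - t - 2) ^ 2 + (1 + W - t - 2) = 1) ∨
      (t ^ 2 + t = 1 ∧ 1 + W - t = t ^ 2) := by
    unfold IsTracePair at h
    exact_mod_cast h
  have h3 (hn : t = -1) := eq_three_of_two_mul_cos_eq_neg_one hl hln hlc (ht.trans hn)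
  have h4 (hm : W = 0) := eq_four_of_two_mul_cos_eq_zero hk hkm hkc (hW.trans hm)
  simp only [IsBraidPair, Prod.mk.injEq]
  rcases h' with h | ⟨ht', h⟩ | ⟨ht', h⟩ | ⟨ht', h⟩ | ⟨ht', h⟩ | ⟨ht', h⟩
  · have hnm : n = m := eq_of_cos_eq_of_coprime hl hln hlc hk hkm hkc (by linarith)
    exact .inr (.inr (.inr (.inr (.inr ⟨m, by omega, hnm, rfl⟩))))
  · exact .inr (.inr (.inl ⟨eq_four_of_two_mul_cos_eq_zero hl hln hlc (ht.trans ht'),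
      eq_three_of_two_mul_cos_eq_neg_one hk hkm hkc (by linarith)⟩))
  · exact .inr (.inr (.inr (.inr (.inl
      ⟨eq_eight_of_sq_two_mul_cos_eq_two hl hln hlc (by rw [ht, ht']),
        eq_six_of_two_mul_cos_eq_one hk hkm hkc (by linarith)⟩))))
  · exact .inl ⟨h3 ht', h4 (by linarith)⟩
  · refine .inr (.inl ⟨h3 ht', eq_five_of_sq_add_two_mul_cos_eq_one hk hkm hkc ?_⟩)
    rw [hW, ← h, ht']
    ring
  · exact .inr (.inr (.inr (.inl
      ⟨eq_five_of_sq_add_two_mul_cos_eq_one hl hln hlc (by rw [ht, ht']), h4 (by linarith)⟩)))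

theorem isTraceRelation_of_sum_eq (hl : 0 < l) (hln : 2 * l < n) (hN : N ≠ 0) (ha : a ^ N = 1)
    (hb : b ^ N = 1) (hc : c ^ N = 1) (habc : a * b * c = 1) (hρ : ρ - 1 = a + b + c)
    (hre : (2 * Real.cos (l * Real.pi / n)) ^ 2 = 2 * ρ.re) :
    IsTraceRelation (N * n) a b c (Complex.exp ((2 * (l * Real.pi / n) : ℝ) * Complex.I)) := by
  have hn : (0 : ℝ) < n := by exact_mod_cast (by omega : 0 < n)
  have hinv {x : ℂ} (hx : x ^ N = 1) : x⁻¹ = conj x :=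
    Complex.inv_eq_conj (Complex.norm_eq_one_of_pow_eq_one hx hN)
  have hpow {x : ℂ} (hx : x ^ N = 1) : x ^ (N * n) = 1 := by rw [pow_mul, hx, one_pow]
  have hsin : 0 < Real.sin (2 * (l * Real.pi / n)) := by
    have hln' : (2 * l : ℝ) < n := by exact_mod_cast hln
    apply Real.sin_pos_of_pos_of_lt_pi (by positivity)
    rw [← mul_div_assoc, div_lt_iff₀ hn]
    nlinarith [Real.pi_pos]
  have hne {x : ℂ} (hx : x.im = 0) :
      Complex.exp ((2 * (l * Real.pi / n) : ℝ) * Complex.I) ≠ x := by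
    rintro rfl
    exact hsin.ne' (by rw [← Complex.exp_ofReal_mul_I_im, hx])
  refine ⟨mul_ne_zero hN (by omega), hpow ha, hpow hb, hpow hc, ?_, habc, ?_, hne Complex.one_im,
    hne (by simp)⟩
  · have hn' : (n : ℂ) ≠ 0 := by exact_mod_cast hn.ne'
    rw [mul_comm N, pow_mul, ← Complex.exp_nat_mul,
      Complex.exp_eq_one_iff.2 ⟨l, by push_cast; field_simp⟩, one_pow]
  · have hsum : a + a⁻¹ + (b + b⁻¹) + (c + c⁻¹) = (ρ - 1) + conj (ρ - 1) := by
      rw [hρ, hinv ha, hinv hb, hinv hc, map_add, map_add]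
      ring
    rw [hsum, Complex.add_conj, Complex.inv_eq_conj (Complex.norm_exp_ofReal_mul_I _),
      Complex.add_conj, Complex.exp_ofReal_mul_I_re, Real.cos_two_mul, Complex.sub_re,
      Complex.one_re]
    congr 1
    linear_combination -hre

theorem isBraidPair_of_sum_eq (hl : 0 < l) (hln : 2 * l < n) (hlc : l.Coprime n) (hk : 0 < k)
    (hkm : 2 * k < m) (hkc : k.Coprime m) (hN : N ≠ 0) (ha : a ^ N = 1)
    (hb : b ^ N = 1) (hc : c ^ N = 1) (habc : a * b * c = 1) (hρ : ρ - 1 = a + b + c)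
    (hre : (2 * Real.cos (l * Real.pi / n)) ^ 2 = 2 * ρ.re)
    (hnorm : ‖ρ‖ = 2 * Real.cos (k * Real.pi / m)) : IsBraidPair n m := by
  have hinv {x : ℂ} (hx : x ^ N = 1) : x⁻¹ = conj x :=
    Complex.inv_eq_conj (Complex.norm_eq_one_of_pow_eq_one hx hN)
  have hadm := (isTraceRelation_of_sum_eq hl hln hN ha hb hc habc hρ hre).isAdmissible
  rw [IsAdmissible, hinv ha, hinv hb, hinv hc, ← map_add, ← map_add, ← hρ, Complex.mul_conj,
    Complex.inv_eq_conj (Complex.norm_exp_ofReal_mul_I _), Complex.add_conj,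
    Complex.exp_ofReal_mul_I_re] at hadm
  refine isBraidPair_of_isTracePair hl hln hlc hk hkm hkc rfl rfl ?_
  convert hadm using 2
  rw [Complex.normSq_sub, Complex.normSq_eq_norm_sq, hnorm, Real.cos_two_mul, Real.cos_two_mul]
  simp only [map_one, mul_one]
  linear_combination -hre

end

/-! ### The table of parameters -/

theorem expPi_re (x : ℝ) : (expPi x).re = Real.cos (Real.pi * x) :=
  Complex.exp_ofReal_mul_I_re _

theorem expPi_im (x : ℝ) : (expPi x).im = Real.sin (Real.pi * x) :=
  Complex.exp_ofReal_mul_I_im _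

theorem expPi_eq (x : ℝ) : expPi x = ⟨Real.cos (Real.pi * x), Real.sin (Real.pi * x)⟩ :=
  Complex.ext (expPi_re x) (expPi_im x)

theorem normSq_expPi (x : ℝ) : Complex.normSq (expPi x) = 1 := by
  rw [expPi, Complex.normSq_eq_norm_sq, Complex.norm_exp_ofReal_mul_I, one_pow]

theorem expPi_add (x y : ℝ) : expPi (x + y) = expPi x * expPi y := by
  rw [expPi, expPi, expPi, ← Complex.exp_add]
  congr 1
  push_cast
  ring

theorem expPi_zero : expPi 0 = 1 := by simp [expPi]

theorem expPi_sub_one (x : ℝ) : expPi (x - 1) = -expPi x := by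
  rw [sub_eq_add_neg, expPi_add, expPi_eq (-1)]
  apply Complex.ext <;> simp

theorem expPi_nsmul (k : ℕ) (x : ℝ) : expPi (k * x) = expPi x ^ k := by
  rw [expPi, expPi, ← Complex.exp_nat_mul]
  congr 1
  push_cast
  ring

theorem expPi_sub_add_expPi_add (x y : ℝ) :
    expPi (x - y) + expPi (x + y) = (2 * Real.cos (Real.pi * y) : ℝ) * expPi x := by
  rw [sub_eq_add_neg, expPi_add, expPi_add, ← mul_add, mul_comm]
  congr 1
  apply Complex.ext
  · simp only [Complex.add_re, expPi_re, mul_neg, Real.cos_neg, Complex.ofReal_re]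
    ring
  · simp only [Complex.add_im, expPi_im, mul_neg, Real.sin_neg, Complex.ofReal_im]
    ring

theorem two_mul_expPi_mul_cos_sub_one (x : ℝ) :
    2 * expPi x * (Real.cos (Real.pi * x) : ℝ) - 1 = expPi (2 * x) := by
  have h := expPi_sub_add_expPi_add x x
  rw [sub_self, expPi_zero, ← two_mul] at h
  push_cast at h ⊢
  linear_combination -h

theorem two_mul_cos_pi_mul_two_fifths_add_one :
    2 * Real.cos (Real.pi * (2 / 5)) + 1 = 2 * Real.cos (Real.pi / 5) := by
  have h5 := Real.sq_sqrt (show (0 : ℝ) ≤ 5 by norm_num)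
  rw [show Real.pi * (2 / 5) = 2 * (Real.pi / 5) by ring, Real.cos_two_mul, Real.cos_pi_div_five]
  linear_combination h5 / 4

theorem two_mul_cos_pi_mul_one_third : 2 * Real.cos (Real.pi * (1 / 3)) = 1 := by
  rw [mul_one_div, Real.cos_pi_div_three]
  norm_num

theorem im_gauss_sum_seven_pos : 0 < (expPi (2 / 7) + expPi (4 / 7) + expPi (-6 / 7)).im := by
  have hpi := Real.pi_pos
  have h₄ : 0 < Real.sin (Real.pi * (4 / 7)) :=
    Real.sin_pos_of_pos_of_lt_pi (by positivity) (by linarith)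
  have h₂ : Real.sin (Real.pi / 7) < Real.sin (Real.pi * (2 / 7)) :=
    Real.sin_lt_sin_of_lt_of_le_pi_div_two (by linarith) (by linarith) (by linarith)
  have h₆ : Real.sin (Real.pi * (-6 / 7)) = -Real.sin (Real.pi / 7) := by
    rw [show Real.pi * (-6 / 7) = -(Real.pi - Real.pi / 7) by ring, Real.sin_neg, Real.sin_pi_sub]
  rw [Complex.add_im, Complex.add_im, expPi_im, expPi_im, expPi_im, h₆]
  linarith

theorem gauss_sum_seven_sq :
    (expPi (2 / 7) + expPi (4 / 7) + expPi (-6 / 7)) ^ 2 +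
      (expPi (2 / 7) + expPi (4 / 7) + expPi (-6 / 7)) + 2 = 0 := by
  have h1 : expPi 2 = 1 := by
    rw [expPi_eq, mul_comm, Real.cos_two_pi, Real.sin_two_pi]
    rfl
  have h₂ : expPi (4 / 7) = expPi (2 / 7) ^ 2 := by
    rw [← expPi_nsmul]
    norm_num
  have h₄ : expPi (-6 / 7) = expPi (2 / 7) ^ 4 := by
    rw [← expPi_nsmul, ← mul_one (expPi _), ← h1, ← expPi_add]
    norm_num
  have h7 : expPi (2 / 7) ^ 7 = 1 := by
    rw [← expPi_nsmul, ← h1]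
    norm_num
  have hne : expPi (2 / 7) ≠ 1 := fun h => by
    have hsin : 0 < Real.sin (Real.pi * (2 / 7)) :=
      Real.sin_pos_of_pos_of_lt_pi (by positivity) (by linarith [Real.pi_pos])
    exact hsin.ne' (by rw [← expPi_im, h, Complex.one_im])
  rw [h₂, h₄]
  refine mul_left_cancel₀ (sub_ne_zero.2 hne) ?_
  linear_combination (2 + expPi (2 / 7) ^ 2 - expPi (2 / 7)) * h7

theorem gauss_sum_seven : expPi (2 / 7) + expPi (4 / 7) + expPi (-6 / 7) =
    (1 + Complex.I * (√7 : ℝ)) / 2 - 1 := by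
  set s := expPi (2 / 7) + expPi (4 / 7) + expPi (-6 / 7)
  have h7 : ((√7 : ℝ) : ℂ) ^ 2 = 7 := by
    exact_mod_cast Real.sq_sqrt (show (0 : ℝ) ≤ 7 by norm_num)
  have hroots : (s - ((1 + Complex.I * (√7 : ℝ)) / 2 - 1)) *
      (s - ((1 - Complex.I * (√7 : ℝ)) / 2 - 1)) = 0 := by
    linear_combination gauss_sum_seven_sq - ((√7 : ℝ) : ℂ) ^ 2 * Complex.I_sq / 4 + h7 / 4
  refine sub_eq_zero.1 ((mul_eq_zero.1 hroots).resolve_right fun h => ?_)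
  have him : s.im = -√7 / 2 := by
    rw [sub_eq_zero.1 h]
    simp
  have hpos : 0 < s.im := im_gauss_sum_seven_pos
  linarith [Real.sqrt_nonneg 7]

/-- The table has a row `(n, m)`, and the numbers `ρ = X` and `σ` in it satisfy
`σ = 2 cos (π/n)`, `σ² = ρ + ρ̄` and `|ρ| = 2 cos (π/m)`. -/
def HasTableRow (n m : ℕ) : Prop :=
  ∃ X : ℂ, IsTableRow n m X (X - 1) (2 * Real.cos (Real.pi / n)) ∧
    (2 * Real.cos (Real.pi / n)) ^ 2 = 2 * X.re ∧
    Complex.normSq X = (2 * Real.cos (Real.pi / m)) ^ 2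

theorem normSq_two_mul_expPi_mul_ofReal (x r : ℝ) :
    Complex.normSq (2 * expPi x * (r : ℂ)) = (2 * r) ^ 2 := by
  simp only [map_mul, normSq_expPi, Complex.normSq_ofReal, Complex.normSq_ofNat]
  ring

theorem re_two_mul_expPi_mul_ofReal (x r : ℝ) :
    (2 * expPi x * (r : ℂ)).re = 2 * Real.cos (Real.pi * x) * r := by
  rw [Complex.re_mul_ofReal, ← expPi_re]
  simp

theorem hasTableRow_diagonal {n : ℕ} (hn : 3 ≤ n) : HasTableRow n n := by
  refine ⟨2 * expPi (1 / n) * (Real.cos (Real.pi / n) : ℝ),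
    .inr (.inr (.inr (.inr (.inr ⟨hn, rfl, rfl, ?_, rfl⟩)))), ?_,
    normSq_two_mul_expPi_mul_ofReal _ _⟩
  · rw [← mul_one_div Real.pi, two_mul_expPi_mul_cos_sub_one, mul_one_div]
  · rw [re_two_mul_expPi_mul_ofReal, mul_one_div]
    ring

theorem hasTableRow_three_four : HasTableRow 3 4 := by
  have h7 := Real.mul_self_sqrt (show (0 : ℝ) ≤ 7 by norm_num)
  have h2 := Real.sq_sqrt (show (0 : ℝ) ≤ 2 by norm_num)
  have hX : (1 + Complex.I * (√7 : ℝ)) / 2 = (⟨1 / 2, √7 / 2⟩ : ℂ) := by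
    apply Complex.ext <;> simp
  refine ⟨_, .inl ⟨rfl, rfl, rfl, gauss_sum_seven.symm, ?_⟩, ?_, ?_⟩
  · rw [Nat.cast_ofNat, Real.cos_pi_div_three]
    norm_num
  · rw [hX, Nat.cast_ofNat, Real.cos_pi_div_three]
    norm_num
  · rw [hX, Complex.normSq_mk, Nat.cast_ofNat, Real.cos_pi_div_four]
    linear_combination h7 / 4 - h2

theorem table_sum_three_five :
    2 * expPi (2 / 5) * (Real.cos (Real.pi / 5) : ℝ) - 1 =
      expPi (2 / 5) + expPi (7 / 15) + expPi (-13 / 15) := by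
  have h₁ := expPi_sub_add_expPi_add (2 / 5) (1 / 5)
  have h₂ := expPi_sub_add_expPi_add (1 / 5) (2 / 5)
  have h₃ := two_mul_expPi_mul_cos_sub_one (1 / 5)
  have h₄ := expPi_sub_add_expPi_add (-(1 / 5)) (2 / 3)
  have hcos := congrArg Complex.ofReal two_mul_cos_pi_mul_two_fifths_add_one
  rw [show Real.pi * (2 / 3) = Real.pi - Real.pi / 3 by ring, Real.cos_pi_sub,
    Real.cos_pi_div_three] at h₄
  rw [mul_one_div] at h₁ h₃
  norm_num at h₁ h₂ h₃ h₄ hcos ⊢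
  linear_combination expPi (1 / 5) * hcos - h₁ + h₂ + h₃ - h₄

theorem hasTableRow_three_five : HasTableRow 3 5 := by
  have h5 := Real.sq_sqrt (show (0 : ℝ) ≤ 5 by norm_num)
  refine ⟨_, .inr (.inl ⟨rfl, rfl, rfl, table_sum_three_five, ?_⟩), ?_, ?_⟩
  · rw [Nat.cast_ofNat, Real.cos_pi_div_three]
    norm_num
  · have hcos : 2 * Real.cos (Real.pi * (2 / 5)) = 2 * Real.cos (Real.pi / 5) - 1 :=
      eq_sub_of_add_eq two_mul_cos_pi_mul_two_fifths_add_one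
    rw [re_two_mul_expPi_mul_ofReal, hcos, Nat.cast_ofNat, Real.cos_pi_div_three,
      Real.cos_pi_div_five]
    linear_combination -h5 / 4
  · exact normSq_two_mul_expPi_mul_ofReal _ _

theorem hasTableRow_four_three : HasTableRow 4 3 := by
  have h2 := Real.sq_sqrt (show (0 : ℝ) ≤ 2 by norm_num)
  refine ⟨1, .inr (.inr (.inl ⟨rfl, rfl, rfl, sub_self 1, ?_⟩)), ?_, ?_⟩
  · rw [Nat.cast_ofNat, Real.cos_pi_div_four]
    ring
  · rw [Nat.cast_ofNat, Real.cos_pi_div_four, Complex.one_re]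
    linear_combination h2
  · rw [Nat.cast_ofNat, Real.cos_pi_div_three, map_one]
    norm_num

theorem table_sum_five_four :
    expPi (-2 / 3) + expPi (2 / 15) + expPi (8 / 15) = ((√5 - 1) / 2 : ℝ) * expPi (1 / 3) := by
  have h₁ : expPi (-2 / 3) = -expPi (1 / 3) := by
    rw [← expPi_sub_one]
    norm_num
  have h₂ : expPi (2 / 15) + expPi (8 / 15) = (2 * Real.cos (Real.pi / 5) : ℝ) * expPi (1 / 3) := by
    rw [← mul_one_div Real.pi, ← expPi_sub_add_expPi_add]
    norm_num
  rw [add_assoc, h₁, h₂, Real.cos_pi_div_five]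
  push_cast
  ring

theorem hasTableRow_five_four : HasTableRow 5 4 := by
  have h5 := Real.sq_sqrt (show (0 : ℝ) ≤ 5 by norm_num)
  have h3 := Real.sq_sqrt (show (0 : ℝ) ≤ 3 by norm_num)
  have h2 := Real.sq_sqrt (show (0 : ℝ) ≤ 2 by norm_num)
  have hX : (1 + Complex.I * (√3 : ℝ)) * ((√5 : ℝ) - Complex.I * (√3 : ℝ)) / 4 =
      ⟨(√5 + 3) / 4, √3 * (√5 - 1) / 4⟩ := by
    apply Complex.ext
    · simp
    · simp
      ring
  refine ⟨_, .inr (.inr (.inr (.inl ⟨rfl, rfl, rfl, ?_, ?_⟩))), ?_, ?_⟩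
  · rw [table_sum_five_four, hX, expPi_eq, mul_one_div, Real.cos_pi_div_three,
      Real.sin_pi_div_three]
    apply Complex.ext
    · simp
      ring
    · simp
      ring
  · rw [Nat.cast_ofNat, Real.cos_pi_div_five]
    ring
  · rw [hX, Nat.cast_ofNat, Real.cos_pi_div_five]
    linear_combination h5 / 4
  · rw [hX, Complex.normSq_mk, Nat.cast_ofNat, Real.cos_pi_div_four]
    linear_combination h5 * (1 + √3 ^ 2) / 16 + h3 * (3 - √5) / 8 - h2

theorem table_sum_eight_six :
    expPi (1 / 2) + expPi (1 / 12) + expPi (-7 / 12) = ⟨√2 / 2, 1 - √2 / 2⟩ := by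
  have h₁ : expPi (1 / 12) + expPi (-7 / 12) = expPi (-(1 / 4)) := by
    have h := expPi_sub_add_expPi_add (-(1 / 4)) (1 / 3)
    rw [two_mul_cos_pi_mul_one_third, Complex.ofReal_one, one_mul] at h
    rw [← h, add_comm]
    norm_num
  rw [add_assoc, h₁, expPi_eq, expPi_eq, mul_one_div, mul_neg, mul_one_div, Real.cos_neg,
    Real.sin_neg, Real.cos_pi_div_two, Real.sin_pi_div_two, Real.cos_pi_div_four,
    Real.sin_pi_div_four]
  apply Complex.ext <;> simp [sub_eq_add_neg]

theorem hasTableRow_eight_six : HasTableRow 8 6 := by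
  have h3 := Real.sq_sqrt (show (0 : ℝ) ≤ 3 by norm_num)
  have h2 := Real.sq_sqrt (show (0 : ℝ) ≤ 2 by norm_num)
  have hcos : 2 * Real.cos (Real.pi / 8) = √(2 + √2) := by
    rw [Real.cos_pi_div_eight]
    ring
  have hX : (1 + Complex.I) * (1 - Complex.I / (√2 : ℝ)) = ⟨1 + √2 / 2, 1 - √2 / 2⟩ := by
    have hinv : ((√2 : ℝ) : ℂ)⁻¹ = ((√2 / 2 : ℝ) : ℂ) := by
      rw [← Complex.ofReal_inv, ← Real.sqrt_div_self]
    rw [div_eq_mul_inv, hinv]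
    apply Complex.ext
    · simp
    · simp
      ring
  refine ⟨_, .inr (.inr (.inr (.inr (.inl ⟨rfl, rfl, rfl, ?_, ?_⟩)))), ?_, ?_⟩
  · rw [table_sum_eight_six, hX]
    apply Complex.ext <;> simp
  · rw [Nat.cast_ofNat, hcos]
  · rw [Nat.cast_ofNat, hcos, Real.sq_sqrt (by positivity), hX]
    ring
  · rw [hX, Complex.normSq_mk, Nat.cast_ofNat, Real.cos_pi_div_six]
    linear_combination h2 / 2 - h3

theorem IsBraidPair.hasTableRow {n m : ℕ} (h : IsBraidPair n m) : HasTableRow n m := by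
  simp only [IsBraidPair, Prod.mk.injEq] at h
  rcases h with ⟨rfl, rfl⟩ | ⟨rfl, rfl⟩ | ⟨rfl, rfl⟩ | ⟨rfl, rfl⟩ | ⟨rfl, rfl⟩ | ⟨k, hk, rfl, rfl⟩
  exacts [hasTableRow_three_four, hasTableRow_three_five, hasTableRow_four_three,
    hasTableRow_five_four, hasTableRow_eight_six, hasTableRow_diagonal hk]

theorem eq_or_conj_eq_of_re_eq_of_normSq_eq {ρ X : ℂ} (hre : ρ.re = X.re)
    (hn : Complex.normSq ρ = Complex.normSq X) : ρ = X ∨ conj ρ = X := by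
  rw [Complex.normSq_apply, Complex.normSq_apply, hre] at hn
  rcases mul_self_eq_mul_self_iff.1 (add_left_cancel hn) with him | him
  · exact .inl (Complex.ext hre him)
  · exact .inr (Complex.ext hre (by rw [Complex.conj_im, him, neg_neg]))

theorem HasTableRow.isTableRow_or_isTableRow_conj {n m : ℕ} {ρ : ℂ} {σ : ℝ} (h : HasTableRow n m)
    (hre : σ ^ 2 = 2 * ρ.re) (hρ : ‖ρ‖ = 2 * Real.cos (Real.pi / m))
    (hσ : σ = 2 * Real.cos (Real.pi / n)) :
    IsTableRow n m ρ (ρ - 1) σ ∨ IsTableRow n m (conj ρ) (conj ρ - 1) σ := by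
  obtain ⟨X, hX, hXre, hXn⟩ := h
  rw [← hσ] at hX hXre
  have hn : Complex.normSq ρ = Complex.normSq X := by rw [hXn, Complex.normSq_eq_norm_sq, hρ]
  rcases eq_or_conj_eq_of_re_eq_of_normSq_eq (by linarith) hn with h | h
  · exact .inl (h ▸ hX)
  · exact .inr (h ▸ hX)

/-! ### Triangle groups with a symmetry -/

section

variable {G : Type*} [Group G] {g h k s : G}

theorem inv_mul_mul_eq_of_conj_eq (hs : s * g * s⁻¹ = g * h * g⁻¹) :
    g⁻¹ * s * g = h * (g⁻¹ * s) := by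
  calc g⁻¹ * s * g = g⁻¹ * (s * g * s⁻¹) * s := by group
    _ = h * (g⁻¹ * s) := by rw [hs]; group

theorem inv_mul_mul_inv_mul_eq_of_conj_eq (hs : s * g * s⁻¹ = g * h * g⁻¹)
    (hsq : s ^ 2 = g * h * k) : g⁻¹ * s * (g⁻¹ * s) = k := by
  apply mul_left_cancel (a := g * h)
  calc g * h * (g⁻¹ * s * (g⁻¹ * s)) = g * (h * (g⁻¹ * s)) * (g⁻¹ * s) := by group
    _ = s ^ 2 := by rw [← inv_mul_mul_eq_of_conj_eq hs, sq]; group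
    _ = g * h * k := hsq

end

section

variable {p : ℕ} {v : Fin 3 → Fin 3 → ℂ} {R₁ R₂ R₃ S : SU21} {ρ : ℂ} {σ τ : ℝ}

theorem isConjugatingRoot_inv_mul (hv : ∀ i, herm21 (v i) (v i) = alphaH p)
    (h₁ : IsComplexReflection p (v 0) R₁) (h₂ : IsComplexReflection p (v 1) R₂)
    (h₃ : IsComplexReflection p (v 2) R₃) (hS₁ : S * R₁ * S⁻¹ = R₁ * R₂ * R₁⁻¹)
    (hSS : S ^ 2 = R₁ * R₂ * R₃) : IsConjugatingRoot p v (su21ToMatrix (R₁⁻¹ * S)) where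
  isometry := (R₁⁻¹ * S).2
  det_eq_one := (R₁⁻¹ * S).1.2
  mul_self := by
    rw [← map_mul, inv_mul_mul_inv_mul_eq_of_conj_eq hS₁ hSS]
    exact h₃.coe_eq (hv 2)
  intertwines := by
    have h : su21ToMatrix (R₁⁻¹ * S) * R₁.1.1 = R₂.1.1 * su21ToMatrix (R₁⁻¹ * S) :=
      congrArg su21ToMatrix (inv_mul_mul_eq_of_conj_eq hS₁)
    rw [h₁.coe_eq (hv 0), h₂.coe_eq (hv 1), mul_smul_comm, smul_mul_assoc] at h
    exact smul_right_injective _ inv_sqrtU_sq_ne_zero h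

theorem symmetryMatrix_inv_mul (hv : herm21 (v 0) (v 0) = alphaH p)
    (h₁ : IsComplexReflection p (v 0) R₁) :
    symmetryMatrix p v (su21ToMatrix (R₁⁻¹ * S)) = su21ToMatrix S := by
  rw [symmetryMatrix, ← h₁.coe_eq hv]
  exact congrArg su21ToMatrix (mul_inv_cancel_left R₁ S)

theorem exists_sum_of_roots_of_unity_of_isOfFinOrder (hp : 2 ≤ p)
    (hS₁ : S * R₁ * S⁻¹ = R₁ * R₂ * R₁⁻¹) (hSS : S ^ 2 = R₁ * R₂ * R₃)
    (hfin : IsOfFinOrder S) (h₁ : IsComplexReflection p (v 0) R₁)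
    (h₂ : IsComplexReflection p (v 1) R₂) (h₃ : IsComplexReflection p (v 2) R₃)
    (hv : HasGramMatrix p v ρ σ τ) (hσ : 0 ≤ σ) (hτ : 0 < τ) :
    σ = τ ∧ σ ^ 2 = 2 * ρ.re ∧ ∃ (N : ℕ) (a b c : ℂ), N ≠ 0 ∧ a ^ N = 1 ∧ b ^ N = 1 ∧ c ^ N = 1 ∧
      a * b * c = 1 ∧ ρ - 1 = a + b + c := by
  have hJ := isConjugatingRoot_inv_mul hv.self h₁ h₂ h₃ hS₁ hSS
  have hS := symmetryMatrix_inv_mul (S := S) (hv.self 0) h₁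
  obtain ⟨rfl, ε, hε, hv₂, hv₀⟩ := hJ.eq_and_exists_mulVec_eq hp hv hσ hτ
  obtain ⟨N, hN, hSN⟩ := isOfFinOrder_iff_pow_eq_one.1 hfin
  obtain ⟨a, b, c, ha, hb, hc, habc, hsum⟩ := hJ.exists_sum_of_roots_of_unity hp hv hε hv₂ hv₀
    (N := N) (by rw [hS]; exact S.1.2) (by rw [hS, ← map_pow, hSN, map_one])
  refine ⟨rfl, ?_, 2 * N, a, b, c, by omega, ha, hb, hc, habc, hsum⟩
  have hre := hJ.conj_add_self_eq hv hε hv₀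
  rw [← Complex.ofReal_mul, Complex.conj_ofReal, add_comm, Complex.add_conj] at hre
  rw [sq]
  exact_mod_cast hre.symm

theorem cos_mul_pi_div_pos {l n : ℕ} (h : 2 * l < n) : 0 < Real.cos (l * Real.pi / n) := by
  have hn : (0 : ℝ) < n := by exact_mod_cast (by omega : 0 < n)
  have h' : (2 * l : ℝ) < n := by exact_mod_cast h
  refine Real.cos_pos_of_mem_Ioo
    ⟨lt_of_lt_of_le (neg_neg_of_pos Real.pi_div_two_pos) (by positivity), ?_⟩
  rw [div_lt_div_iff₀ hn two_pos]
  nlinarith [Real.pi_pos]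

theorem HasParameters.spec {n m : ℕ} (hv : HasParameters p R₁ R₂ R₃ ρ σ τ) (hp : 2 ≤ p)
    (hS₁ : S * R₁ * S⁻¹ = R₁ * R₂ * R₁⁻¹) (hSS : S ^ 2 = R₁ * R₂ * R₃)
    (hfin : IsOfFinOrder (R₁ * R₂ * R₃)) (hn : 3 ≤ n) (hm : 3 ≤ m)
    (hbn : HasBraidLength R₁ R₃ n) (hbm : HasBraidLength R₁ R₂ m) (hσ : 0 ≤ σ) (hτ : 0 ≤ τ) :
    σ = τ ∧ σ ^ 2 = 2 * ρ.re ∧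
      (∃ k : ℕ, 0 < k ∧ 2 * k < m ∧ k.Coprime m ∧ ‖ρ‖ = 2 * Real.cos (k * Real.pi / m)) ∧
      (∃ l : ℕ, 0 < l ∧ 2 * l < n ∧ l.Coprime n ∧ σ = 2 * Real.cos (l * Real.pi / n)) ∧
      IsBraidPair n m := by
  obtain ⟨v, h₁, h₂, h₃, hH⟩ := hv
  have hv := hasGramMatrix_iff.2 hH
  obtain ⟨l, hl, hln, hlc, hlτ⟩ := hbn.exists_norm_herm21_eq h₁ h₃ (hv.self 0) (hv.self 2) hn
  obtain ⟨k, hk, hkm, hkc, hkρ⟩ := hbm.exists_norm_herm21_eq h₁ h₂ (hv.self 0) (hv.self 1) hm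
  rw [hv.zero_two, norm_mul, norm_phaseH, one_mul, Complex.norm_of_nonneg hτ] at hlτ
  rw [← herm21_conj, RCLike.norm_conj, hv.one_zero, norm_mul, norm_phaseH, one_mul] at hkρ
  have hτ₀ : 0 < τ := hlτ ▸ mul_pos two_pos (cos_mul_pi_div_pos hln)
  have hSfin : IsOfFinOrder S := .of_pow (hSS ▸ hfin) two_ne_zero
  obtain ⟨rfl, hre, N, a, b, c, hN, ha, hb, hc, habc, hsum⟩ :=
    exists_sum_of_roots_of_unity_of_isOfFinOrder hp hS₁ hSS hSfin h₁ h₂ h₃ hv hσ hτ₀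
  exact ⟨rfl, hre, ⟨k, hk, hkm, hkc, hkρ⟩, ⟨l, hl, hln, hlc, hlτ⟩,
    isBraidPair_of_sum_eq hl hln hlc hk hkm hkc hN ha hb hc habc hsum (hlτ ▸ hre) hkρ⟩

end

theorem theorem2p4 (p : ℕ) (hp : 2 ≤ p) (R₁ R₂ R₃ S : SU21)
    (hR₁ : ∃ v, IsComplexReflection p v R₁)
    (hR₂ : ∃ v, IsComplexReflection p v R₂)
    (hR₃ : ∃ v, IsComplexReflection p v R₃)
    (hS₁ : S * R₁ * S⁻¹ = R₁ * R₂ * R₁⁻¹)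
    (hS₂ : S * R₂ * S⁻¹ = R₁ * R₃ * R₁ * R₃⁻¹ * R₁⁻¹)
    (hS₃ : S * R₃ * S⁻¹ = R₁ * R₃ * R₁⁻¹)
    (hSS : S ^ 2 = R₁ * R₂ * R₃)
    (n m : ℕ) (hn : 3 ≤ n) (hm : 3 ≤ m)
    (hbn : HasBraidLength R₁ R₃ n) (hbm : HasBraidLength R₁ R₂ m)
    (hfin : IsOfFinOrder (R₁ * R₂ * R₃)) :
    ((n, m) = (3, 4) ∨ (n, m) = (3, 5) ∨ (n, m) = (4, 3) ∨ (n, m) = (5, 4) ∨ (n, m) = (8, 6) ∨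
      ∃ k : ℕ, 3 ≤ k ∧ (n, m) = (k, k)) ∧
    (∃ (ρ : ℂ) (σ τ : ℝ), 0 ≤ σ ∧ 0 ≤ τ ∧ HasParameters p R₁ R₂ R₃ ρ σ τ) ∧
    ∀ (ρ : ℂ) (σ τ : ℝ), 0 ≤ σ → 0 ≤ τ → HasParameters p R₁ R₂ R₃ ρ σ τ →
      σ = τ ∧ σ ^ 2 = 2 * ρ.re ∧
      (∃ k : ℕ, 0 < k ∧ 2 * k < m ∧ k.Coprime m ∧ ‖ρ‖ = 2 * Real.cos (k * Real.pi / m)) ∧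
      (∃ l : ℕ, 0 < l ∧ 2 * l < n ∧ l.Coprime n ∧ σ = 2 * Real.cos (l * Real.pi / n)) ∧
      (‖ρ‖ = 2 * Real.cos (Real.pi / m) → σ = 2 * Real.cos (Real.pi / n) →
        IsTableRow n m ρ (ρ - 1) σ ∨ IsTableRow n m (conj ρ) (conj ρ - 1) σ) := by
  have spec {ρ : ℂ} {σ τ : ℝ} (hσ : 0 ≤ σ) (hτ : 0 ≤ τ) (h : HasParameters p R₁ R₂ R₃ ρ σ τ) :=
    h.spec hp hS₁ hSS hfin hn hm hbn hbm hσ hτ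
  obtain ⟨ρ₀, σ₀, τ₀, hσ₀, hτ₀, h₀⟩ := exists_hasParameters hp hR₁ hR₂ hR₃
  obtain ⟨-, -, -, -, hpair⟩ := spec hσ₀ hτ₀ h₀
  refine ⟨hpair, ⟨ρ₀, σ₀, τ₀, hσ₀, hτ₀, h₀⟩, fun ρ σ τ hσ hτ h => ?_⟩
  obtain ⟨hστ, hre, hρ, hσn, -⟩ := spec hσ hτ h
  exact ⟨hστ, hre, hρ, hσn, hpair.hasTableRow.isTableRow_or_isTableRow_conj hre⟩
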